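/- Let $n_d,n_c\ge 0$ be integers, $q=\max(n_d,n_c)$, and for $u\le q$ let $S_u\in\mathbb F_2^{q\times q}$ be the matrix with the identity $I_u$ in its lower left corner and zeros elsewhere. Over a block of $N$ channel uses, the quasi-static bursty interference channel maps the inputs $X_1,X_2\in\mathbb F_2^{q\times N}$ to $$Y_1=S_{n_d}X_1\oplus B_1S_{n_c}X_2,\qquad Y_2=S_{n_d}X_2\oplus B_2S_{n_c}X_1,$$ where the interference states $B_1,B_2$ are Bernoulli variables with $\Pr\{B_i=1\}=p$, constant over the block, and either independent or fully correlated ($B_1=B_2$). Receiver $i$ knows $B_i$. Under local CSIR the transmitters do not know the states; under local CSIRT transmitter $i$ knows $B_i$. User $i$ has a worst-case message $W_i\in\{1,\dots,\lfloor 2^{NR_i}\rfloor\}$ and opportunistic messages $\Delta W_i(v)\in\{1,\dots,\lfloor 2^{N\Delta R_i(v)}\rfloor\}$, $v\in\{0,1\}$, all independent, uniform, and independent of the states; all rates are nonnegative and $\Delta R_i(1)=0$. Encoder $i$ maps its messages (and $B_i$, under local CSIRT) to $X_i$; decoder $i$ maps $(Y_i,B_i)$ to $(\hat W_i,\Delta\hat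 W_i(B_i))$. A tuple $(R_1,R_2,\{\Delta R_1(\cdot)\},\{\Delta R_2(\cdot)\})$ is achievable if there is a sequence of such codes with $\Pr\{\hat W_1\ne W_1\text{ or }\hat W_2\ne W_2\}\to 0$ and $\Pr\{(\hat W_i,\Delta\hat W_i(B_i))\ne(W_i,\Delta W_i(B_i))\mid B_i=v\}\to 0$ for $i=1,2$ and $v=0,1$, as $N\to\infty$. The capacity region is the closure of the set of achievable tuples, and the opportunistic sum capacity region is the set of the tuples $\bigl(R,\{\Delta R_1(b_1)+\Delta R_2(b_2)\}_{b_1,b_2\in\{0,1\}}\bigr)$, $R=R_1+R_2$, obtained from the tuples in the capacity region. **Theorem.** Let $0<p<1$. In each of the three cases (i) local CSIR and independent $B_1,B_2$, (ii) local CSIRT and independent $B_1,B_2$, (iii) local CSIR and $B_1=B_2$, the opportunistic sum capacity region is the set of all tuples $\bigl(R,\{\Delta R_1(b_1)+\Delta R_2(b_2)\}_{b_1,b_2\in\{0,1\}}\bigr)$ with $\Delta R_1(1)=\Delta R_2(1)=0$ and $R,\Delta R_1(0),\Delta R_2(0)\ge 0$ such that $$R\le 2n_d,\qquad R\le (n_d-n_c)^++\max(n_d,n_c),\qquad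 R\le 2\max\{(n_d-n_c)^+,n_c\},$$ $$R+\Delta R_1(0)+\Delta R_2(0)\le 2n_d,$$ $$R+\Delta R_i(0)\le (n_d-n_c)^++\max(n_d,n_c),\qquad i=1,2,$$ and the single-user bounds $\Delta R_i(0)\le n_d$, $i=1,2$, hold. In particular, the region is the same in the three cases; for independent states, local state information at the transmitters does not enlarge it. -/

import Mathlib

open Filter Topology

namespace BurstyIC

/-- Channel-state information: the receivers always know their own state; under local CSIRT
transmitter `i` also knows the state of receiver `i`. -/
inductive CSI
  | localCSIR
  | localCSIRT

/-- Joint behaviour of the two interference states. -/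
inductive StateModel
  | independent
  | fullyCorrelated

/-- A realization of the pair of interference states; `true` means interference is present. -/
abbrev States : Type := Fin 2 → Bool

/-- The Bernoulli law with activation probability `p`. -/
def bern (p : ℝ) (b : Bool) : ℝ := if b then p else 1 - p

/-- The joint law of the interference states: two independent Bernoulli variables, or two equal
ones. -/
def stateLaw (p : ℝ) : StateModel → States → ℝ
  | .independent, b => bern p (b 0) * bern p (b 1)
  | .fullyCorrelated, b => if b 0 = b 1 then bern p (b 0) else 0

/-- The `q × q` down-shift matrix with block `I_u` in the lower left corner (`u ≤ q`). -/
def shift (q u : ℕ) : Matrix (Fin q) (Fin q) (ZMod 2) :=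
  Matrix.of fun i j => if (i : ℕ) = (j : ℕ) + (q - u) then 1 else 0

/-- A block of `N` channel inputs (or outputs) with `max nd nc` binary levels each. -/
abbrev Block (nd nc N : ℕ) : Type := Matrix (Fin (max nd nc)) (Fin N) (ZMod 2)

/-- The output at receiver `i`; the interfering user is `1 - i`. -/
def output (nd nc N : ℕ) (x : Fin 2 → Block nd nc N) (b : States) (i : Fin 2) :
    Block nd nc N :=
  shift (max nd nc) nd * x i +
    (if b i then (1 : ZMod 2) else 0) • (shift (max nd nc) nc * x (1 - i))

/-- A rate tuple: the worst-case rates `R_i` and the opportunistic rates `ΔR_i(v)`. -/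
abbrev RateTuple : Type := (Fin 2 → ℝ) × (Fin 2 → Bool → ℝ)

/-- The message set `{1, …, 2 ^ (N * ρ)}` (its number of elements is the integer part of
`2 ^ (N * ρ)`). -/
abbrev Msg (N : ℕ) (ρ : ℝ) : Type := Fin ⌊(2 : ℝ) ^ ((N : ℝ) * ρ)⌋₊

/-- All the messages of user `i`: the worst-case message and one opportunistic message for every
state of the receiver. -/
abbrev UserMsg (N : ℕ) (r : RateTuple) (i : Fin 2) : Type :=
  Msg N (r.1 i) × ((v : Bool) → Msg N (r.2 i v))

/-- The messages of both users. -/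
abbrev Messages (N : ℕ) (r : RateTuple) : Type := (i : Fin 2) → UserMsg N r i

/-- The side information available at a transmitter. -/
def TxInfo : CSI → Type
  | .localCSIR => Unit
  | .localCSIRT => Bool

/-- The side information at a transmitter as a function of its state. -/
def txInfo : (c : CSI) → Bool → TxInfo c
  | .localCSIR, _ => ()
  | .localCSIRT, b => b

/-- An opportunistic code of block length `N`. -/
structure OppCode (nd nc : ℕ) (c : CSI) (N : ℕ) (r : RateTuple) where
  /-- the encoders -/
  enc : (i : Fin 2) → UserMsg N r i → TxInfo c → Block nd nc N
  /-- the decoders -/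
  dec : (i : Fin 2) → Block nd nc N → (v : Bool) → Msg N (r.1 i) × Msg N (r.2 i v)

variable {nd nc : ℕ} {c : CSI} {N : ℕ} {r : RateTuple}

/-- The pair of messages decoded by receiver `i` when `w` is sent in state `b`. -/
def OppCode.decoded (C : OppCode nd nc c N r) (w : Messages N r) (b : States) (i : Fin 2) :
    Msg N (r.1 i) × Msg N (r.2 i (b i)) :=
  C.dec i (output nd nc N (fun j => C.enc j (w j) (txInfo c (b j))) b i) (b i)

open Classical in
/-- The probability of an event in the messages and the states: the messages are independent and
uniformly distributed, and independent of the states. -/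
noncomputable def prob (p : ℝ) (κ : StateModel) (N : ℕ) (r : RateTuple)
    (E : Messages N r → States → Prop) : ℝ :=
  ∑ w : Messages N r, ∑ b : States,
    if E w b then (Fintype.card (Messages N r) : ℝ)⁻¹ * stateLaw p κ b else 0

/-- The probability that a worst-case message is decoded wrongly. -/
noncomputable def OppCode.worstErr (C : OppCode nd nc c N r) (p : ℝ) (κ : StateModel) : ℝ :=
  prob p κ N r fun w b => ∃ i, (C.decoded w b i).1 ≠ (w i).1

/-- The conditional probability, given that the state of receiver `i` is `v`, that this receiver
decodes its worst-case message or its opportunistic message for this state wrongly. -/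
noncomputable def OppCode.oppErr (C : OppCode nd nc c N r) (p : ℝ) (κ : StateModel)
    (i : Fin 2) (v : Bool) : ℝ :=
  prob p κ N r (fun w b => b i = v ∧ C.decoded w b i ≠ ((w i).1, (w i).2 (b i))) /
    prob p κ N r (fun _ b => b i = v)

/-- Achievability of a tuple of (nonnegative) rates, with `ΔR_i(1) = 0`. -/
def Achievable (nd nc : ℕ) (c : CSI) (κ : StateModel) (p : ℝ) (r : RateTuple) : Prop :=
  (∀ i, 0 ≤ r.1 i) ∧ (∀ i v, 0 ≤ r.2 i v) ∧ (∀ i, r.2 i true = 0) ∧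
    ∃ C : (N : ℕ) → OppCode nd nc c N r,
      Tendsto (fun N => (C N).worstErr p κ) atTop (𝓝 0) ∧
      ∀ i v, Tendsto (fun N => (C N).oppErr p κ i v) atTop (𝓝 0)

/-- The capacity region: the closure of the set of achievable rate tuples. -/
def capacityRegion (nd nc : ℕ) (c : CSI) (κ : StateModel) (p : ℝ) : Set RateTuple :=
  closure {r | Achievable nd nc c κ p r}

/-- The worst-case sum rate together with the opportunistic sum rates
`ΔR_1(b_1) + ΔR_2(b_2)` for all pairs of states. -/
def sumRates (r : RateTuple) : ℝ × (States → ℝ) :=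
  (r.1 0 + r.1 1, fun b => r.2 0 (b 0) + r.2 1 (b 1))

/-- The opportunistic sum capacity region. -/
def oppSumCapacityRegion (nd nc : ℕ) (c : CSI) (κ : StateModel) (p : ℝ) :
    Set (ℝ × (States → ℝ)) :=
  sumRates '' capacityRegion nd nc c κ p

/-- The set of tuples `(R, (ΔR_1(b_1) + ΔR_2(b_2))_b)` of nonnegative rates that satisfy the
worst-case bounds, the opportunistic bounds and the single-user bounds. -/
def boundRegion (nd nc : ℕ) : Set (ℝ × (States → ℝ)) :=
  {t | ∃ (R : ℝ) (D : Fin 2 → Bool → ℝ),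
    t = (R, fun b => D 0 (b 0) + D 1 (b 1)) ∧
    0 ≤ R ∧ (∀ i, 0 ≤ D i false) ∧ (∀ i, D i true = 0) ∧
    R ≤ 2 * nd ∧
    R ≤ max ((nd : ℝ) - nc) 0 + max (nd : ℝ) nc ∧
    R ≤ 2 * max (max ((nd : ℝ) - nc) 0) nc ∧
    R + D 0 false + D 1 false ≤ 2 * nd ∧
    (∀ i, R + D i false ≤ max ((nd : ℝ) - nc) 0 + max (nd : ℝ) nc) ∧
    (∀ i, D i false ≤ nd)}

end BurstyIC

/-!
The region is the same in all three cases because each outer bound only involves the receivers in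
one pair of states, and each inner bound is attained by a code whose transmitters ignore the states
and which never errs.

*Outer bounds.* For every pair `b` of states, each receiver of a reliable code decodes correctly
for all but a small fraction of the messages. For independent states every pair has positive
probability; for `B₁ = B₂` and local CSIR, what a receiver sees depends on its own state only, so
that pairs of unequal states may be used as well (`eventually_card_not_correct_le`). The bounds on
the rates then follow by counting the messages that are decoded correctly. Without interference
they are determined by the output (`card_single_user_le`). If only receiver `j` is interfered with,
it learns the interference after decoding, and its output together with the `(nd - nc)⁺` levels of
user `i` that it does not see determines the messages of both users (`card_one_interfered_le`).
If both are interfered with, the bound `R ≤ 2 max ((nd - nc)⁺, nc)` is the counting version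
`card_mul_card_le` of the genie-aided bound `H(Y₁ | V₁) + H(Y₂ | V₂)`, where `Vᵢ` is the
interference that user `i` causes. The entropies of `V₁` and `V₂`, which cancel in the sum of the
two single-user estimates, are replaced by the numbers `halfSize` of values that cover half of the
messages. This makes the argument insensitive to a small fraction of errors.

*Inner bounds.* If the first `a i` of the `k i` bits of user `i` are decodable in the presence of
interference and all of them in its absence, the first ones carry the worst-case message and the
others the opportunistic message; worst-case bits may be turned into opportunistic ones. Five codes
for a single channel use, one or two for each range of `nc / nd`, and time sharing between them
give all points of the region. For small `R` one symmetric code suffices, in which the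
worst-case bits use the levels that are free of interference. For larger `R` it is combined with
a code of maximal worst-case sum rate: for `1/2 ≤ nc / nd ≤ 2/3` each user keeps some levels
silent, and otherwise one of the users repeats bits so that interference can be resolved.
-/

namespace BurstyIC

/-! ### Counting bounds for deterministic interference channels -/

section Counting

open Classical in
/-- The least number of values of `f` whose fibres cover at least half of the domain of `f`. It
plays the role of the (exponential of the) entropy of `f` at a uniform argument. -/
noncomputable def halfSize {W V : Type*} [Fintype W] (f : W → V) : ℕ :=
  sInf {k | ∃ T : Finset V, T.card = k ∧
    Fintype.card W ≤ 2 * (Finset.univ.filter fun w => f w ∈ T).card}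

open Classical in
theorem exists_card_eq_halfSize {W V : Type*} [Fintype W] (f : W → V) :
    ∃ T : Finset V, T.card = halfSize f ∧
      Fintype.card W ≤ 2 * (Finset.univ.filter fun w => f w ∈ T).card := by
  apply Nat.sInf_mem (s := {k | ∃ T : Finset V, T.card = k ∧
    Fintype.card W ≤ 2 * (Finset.univ.filter fun w => f w ∈ T).card})
  refine ⟨_, Finset.univ.image f, rfl, ?_⟩
  rw [Finset.filter_true_of_mem (fun w _ => Finset.mem_image_of_mem f (Finset.mem_univ w)),
    Finset.card_univ]
  omega

open Classical in
theorem halfSize_le {W V : Type*} [Fintype W] (f : W → V) (S : Finset W)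
    (hS : Fintype.card W ≤ 2 * S.card) : halfSize f ≤ (S.image f).card := by
  refine Nat.sInf_le ⟨_, rfl, hS.trans (Nat.mul_le_mul_left 2 (Finset.card_le_card ?_))⟩
  intro w hw
  simpa using ⟨w, hw, rfl⟩

theorem halfSize_pos {W V : Type*} [Fintype W] [Nonempty W] (f : W → V) : 0 < halfSize f := by
  classical
  obtain ⟨T, hT, h⟩ := exists_card_eq_halfSize f
  rw [← hT, Finset.card_pos, Finset.nonempty_iff_ne_empty]
  rintro rfl
  have := Fintype.card_pos (α := W)
  simp at h

/-- If in a set `G` of `7/8` of all pairs the pair `(f₁ w₁, τ (w₁, w₂))` determines `w₁` and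
`f₂ w₂`, then `|W₁|` is at most `4 |T|` times the quotient of the half sizes of `f₁` and `f₂`. -/
theorem card_mul_halfSize_le {W₁ W₂ V₁ V₂ T : Type*} [Fintype W₁] [Fintype W₂] [Nonempty W₁]
    [Nonempty W₂] [Fintype T] (f₁ : W₁ → V₁) (f₂ : W₂ → V₂) (τ : W₁ × W₂ → T) (G : Finset (W₁ × W₂))
    (hG : 7 * (Fintype.card W₁ * Fintype.card W₂) ≤ 8 * G.card)
    (h : ∀ w ∈ G, ∀ w' ∈ G, f₁ w.1 = f₁ w'.1 → τ w = τ w' → w.1 = w'.1 ∧ f₂ w.2 = f₂ w'.2) :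
    Fintype.card W₁ * halfSize f₂ ≤ 4 * (halfSize f₁ * Fintype.card T) := by
  classical
  obtain ⟨S, hS, hcov⟩ := exists_card_eq_halfSize f₁
  set A := Fintype.card W₁
  set B := Fintype.card W₂
  have hB : 0 < B := Fintype.card_pos
  let F : W₁ → Finset W₂ := fun w => Finset.univ.filter fun w₂ => (w, w₂) ∈ G
  let rich : Finset W₁ := Finset.univ.filter fun w => B ≤ 2 * (F w).card
  -- at least three quarters of all `w₁` have at least half of all `w₂` as partners in `G`
  have hrich : 3 * A ≤ 4 * rich.card := by
    have hsum : G.card = ∑ w : W₁, (F w).card := by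
      rw [Finset.card_eq_sum_card_fiberwise (f := Prod.fst) (t := Finset.univ)
        (fun _ _ => Finset.mem_coe.2 (Finset.mem_univ _))]
      refine Finset.sum_congr rfl fun w _ => ?_
      rw [← Finset.card_image_of_injective (F w) (Prod.mk_right_injective w)]
      congr 1
      ext ⟨x, y⟩
      simp only [Finset.mem_filter, Finset.mem_image, F, Finset.mem_univ, true_and,
        Prod.mk.injEq]
      constructor
      · rintro ⟨hxy, rfl⟩
        exact ⟨y, hxy, rfl, rfl⟩
      · rintro ⟨y, hxy, rfl, rfl⟩
        exact ⟨hxy, rfl⟩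
    have hle : 2 * G.card ≤ ∑ w : W₁, (B + if w ∈ rich then B else 0) := by
      rw [hsum, Finset.mul_sum]
      refine Finset.sum_le_sum fun w _ => ?_
      have h1 : (F w).card ≤ B := Finset.card_le_univ _
      by_cases hw : w ∈ rich
      · simp only [hw, if_true]
        omega
      · simp only [hw, if_false]
        simp only [rich, Finset.mem_filter, Finset.mem_univ, true_and, not_le] at hw
        omega
    rw [Finset.sum_add_distrib, Finset.sum_const, ← Finset.sum_filter, Finset.sum_const,
      Finset.filter_mem_eq_inter, Finset.univ_inter, Finset.card_univ, smul_eq_mul,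
      smul_eq_mul] at hle
    change 2 * G.card ≤ A * B + rich.card * B at hle
    have : 3 * A * B ≤ 4 * rich.card * B := by nlinarith
    exact Nat.le_of_mul_le_mul_right this hB
  let Q : Finset W₁ := rich ∩ Finset.univ.filter fun w => f₁ w ∈ S
  have hQ : A ≤ 4 * Q.card := by
    have h1 := Finset.card_union_add_card_inter rich (Finset.univ.filter fun w => f₁ w ∈ S)
    have h2 : (rich ∪ Finset.univ.filter fun w => f₁ w ∈ S).card ≤ A := Finset.card_le_univ _
    change _ + Q.card = _ at h1
    omega
  let G' := G.filter fun w => w.1 ∈ Q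
  let I : Finset (W₁ × V₂) := G'.image fun w => (w.1, f₂ w.2)
  have hI₁ : Q.card * halfSize f₂ ≤ I.card := by
    rw [Finset.card_eq_sum_card_fiberwise (f := Prod.fst) (s := I) (t := Q), ← smul_eq_mul]
    · refine Finset.card_nsmul_le_sum _ _ _ fun w hw => ?_
      have hw' : B ≤ 2 * (F w).card := by
        have := (Finset.mem_inter.1 hw).1
        simpa [rich] using this
      refine (halfSize_le f₂ (F w) hw').trans ?_
      rw [← Finset.card_image_of_injective _ (Prod.mk_right_injective w)]
      refine Finset.card_le_card fun x hx => ?_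
      obtain ⟨v, hv, rfl⟩ := Finset.mem_image.1 hx
      obtain ⟨w₂, hw₂, rfl⟩ := Finset.mem_image.1 hv
      have hG2 : (w, w₂) ∈ G := by simpa [F] using hw₂
      exact Finset.mem_filter.2 ⟨Finset.mem_image.2
        ⟨(w, w₂), Finset.mem_filter.2 ⟨hG2, hw⟩, rfl⟩, rfl⟩
    · intro x hx
      obtain ⟨w, hw, rfl⟩ := Finset.mem_image.1 (Finset.mem_coe.1 hx)
      exact Finset.mem_coe.2 (Finset.mem_filter.1 hw).2
  have hI₂ : I.card ≤ S.card * Fintype.card T := by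
    rw [← Finset.card_univ (α := T), ← Finset.card_product]
    have hex : ∀ x ∈ I, ∃ w ∈ G', (w.1, f₂ w.2) = x := fun x hx => Finset.mem_image.1 hx
    choose! g hg hgx using hex
    refine Finset.card_le_card_of_injOn (fun x => (f₁ (g x).1, τ (g x))) ?_ ?_
    · intro x hx
      have h1 := (Finset.mem_filter.1 (hg x hx)).2
      have h2 := (Finset.mem_inter.1 h1).2
      simp only [Finset.coe_product, Set.mem_prod, Finset.mem_coe, Finset.mem_univ, and_true]
      simpa using h2
    · intro x hx y hy hxy
      simp only [Prod.mk.injEq] at hxy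
      obtain ⟨h1, h2⟩ := h _ (Finset.mem_filter.1 (hg x hx)).1 _
        (Finset.mem_filter.1 (hg y hy)).1 hxy.1 hxy.2
      rw [← hgx x hx, ← hgx y hy, h1, h2]
  calc A * halfSize f₂ ≤ 4 * Q.card * halfSize f₂ := Nat.mul_le_mul_right _ hQ
    _ = 4 * (Q.card * halfSize f₂) := by ring
    _ ≤ 4 * (halfSize f₁ * Fintype.card T) := by
        rw [← hS]
        exact Nat.mul_le_mul_left 4 (hI₁.trans hI₂)

/-- A counting form of the sum-rate bound `H(Y₁ | V₁) + H(Y₂ | V₂)` for deterministic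
interference channels: `f₁` and `f₂` are the interferences that the users cause, and `τᵢ` is what
receiver `i` learns from its output beyond its own `fᵢ`. In the product of the two estimates the
half sizes of `f₁` and `f₂` cancel. -/
theorem card_mul_card_le {W₁ W₂ V₁ V₂ T₁ T₂ : Type*} [Fintype W₁] [Fintype W₂] [Nonempty W₁]
    [Nonempty W₂] [Fintype T₁] [Fintype T₂] (f₁ : W₁ → V₁) (f₂ : W₂ → V₂)
    (τ₁ : W₁ × W₂ → T₁) (τ₂ : W₁ × W₂ → T₂) (G : Finset (W₁ × W₂))
    (hG : 7 * (Fintype.card W₁ * Fintype.card W₂) ≤ 8 * G.card)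
    (h₁ : ∀ w ∈ G, ∀ w' ∈ G, f₁ w.1 = f₁ w'.1 → τ₁ w = τ₁ w' →
      w.1 = w'.1 ∧ f₂ w.2 = f₂ w'.2)
    (h₂ : ∀ w ∈ G, ∀ w' ∈ G, f₂ w.2 = f₂ w'.2 → τ₂ w = τ₂ w' →
      w.2 = w'.2 ∧ f₁ w.1 = f₁ w'.1) :
    Fintype.card W₁ * Fintype.card W₂ ≤ 16 * (Fintype.card T₁ * Fintype.card T₂) := by
  have e₁ := card_mul_halfSize_le f₁ f₂ τ₁ G hG h₁
  have e₂ := card_mul_halfSize_le f₂ f₁ (fun w => τ₂ w.swap)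
    (G.map (Equiv.prodComm W₁ W₂).toEmbedding)
    (by rw [Finset.card_map, mul_comm (Fintype.card W₂)]; exact hG)
    (by
      intro w hw w' hw' h h'
      obtain ⟨x, hx, rfl⟩ := Finset.mem_map.1 hw
      obtain ⟨x', hx', rfl⟩ := Finset.mem_map.1 hw'
      exact h₂ x hx x' hx' h h')
  have p₁ := halfSize_pos f₁
  have p₂ := halfSize_pos f₂
  refine Nat.le_of_mul_le_mul_right (c := halfSize f₁ * halfSize f₂) ?_ (Nat.mul_pos p₁ p₂)
  calc Fintype.card W₁ * Fintype.card W₂ * (halfSize f₁ * halfSize f₂)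
      = (Fintype.card W₁ * halfSize f₂) * (Fintype.card W₂ * halfSize f₁) := by ring
    _ ≤ (4 * (halfSize f₁ * Fintype.card T₁)) * (4 * (halfSize f₂ * Fintype.card T₂)) :=
        Nat.mul_le_mul e₁ e₂
    _ = _ := by ring

end Counting

/-! ### Rows of the channel outputs -/

section Rows

variable {q N : ℕ}

/-- Row `k` of a block, padded by zero rows. -/
def rowOf (X : Matrix (Fin q) (Fin N) (ZMod 2)) (k : ℕ) (t : Fin N) : ZMod 2 :=
  if h : k < q then X ⟨k, h⟩ t else 0

theorem shift_mul_apply (u : ℕ) (X : Matrix (Fin q) (Fin N) (ZMod 2)) (k : Fin q) (t : Fin N) :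
    (shift q u * X) k t = if q - u ≤ k then rowOf X (k - (q - u)) t else 0 := by
  rw [Matrix.mul_apply]
  by_cases h : q - u ≤ k
  · have hk : (k : ℕ) - (q - u) < q := by omega
    rw [if_pos h, rowOf, dif_pos hk, Finset.sum_eq_single ⟨(k : ℕ) - (q - u), hk⟩]
    · simp [shift, h]
    · intro j _ hj
      have : (k : ℕ) ≠ j + (q - u) := by
        intro h'
        exact hj (Fin.ext (by simp only; omega))
      simp [shift, this]
    · simp
  · rw [if_neg h]
    refine Finset.sum_eq_zero fun j _ => ?_
    have : (k : ℕ) ≠ j + (q - u) := by omega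
    simp [shift, this]

/-- `shift q u * X` consists of the first `u` rows of `X`. -/
theorem shift_mul_eq_iff {u : ℕ} (hu : u ≤ q) (X X' : Matrix (Fin q) (Fin N) (ZMod 2)) :
    shift q u * X = shift q u * X' ↔ ∀ k < u, ∀ t, rowOf X k t = rowOf X' k t := by
  constructor
  · intro h k hk t
    have := congrFun (congrFun h ⟨k + (q - u), by omega⟩) t
    rw [shift_mul_apply, shift_mul_apply] at this
    simpa using this
  · intro h
    ext k t
    rw [shift_mul_apply, shift_mul_apply]
    split_ifs with hk
    · exact h _ (by omega) t
    · rfl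

end Rows

/-! ### From error probabilities to numbers of messages -/

section Errors

variable {nd nc : ℕ} {c : CSI} {N : ℕ} {r : RateTuple} {p : ℝ}

theorem bern_pos (hp0 : 0 < p) (hp1 : p < 1) (b : Bool) : 0 < bern p b := by
  cases b <;> simp [bern, hp0, hp1]

theorem stateLaw_nonneg (hp0 : 0 < p) (hp1 : p < 1) (κ : StateModel) (b : States) :
    0 ≤ stateLaw p κ b := by
  have h := fun b => (bern_pos hp0 hp1 b).le
  cases κ
  · exact mul_nonneg (h _) (h _)
  · simp only [stateLaw]
    split_ifs
    exacts [h _, le_rfl]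

theorem sum_stateLaw (κ : StateModel) : ∑ b : States, stateLaw p κ b = 1 := by
  rw [← (finTwoArrowEquiv Bool).symm.sum_comp, Fintype.sum_prod_type]
  cases κ
  · simp [stateLaw, bern]
    ring
  · simp [stateLaw, bern]

theorem one_le_card_msg (N : ℕ) {ρ : ℝ} (hρ : 0 ≤ ρ) : 1 ≤ ⌊(2 : ℝ) ^ ((N : ℝ) * ρ)⌋₊ :=
  Nat.le_floor (by
    rw [Nat.cast_one]
    exact Real.one_le_rpow (by norm_num) (by positivity))

theorem nonempty_msg (N : ℕ) {ρ : ℝ} (hρ : 0 ≤ ρ) : Nonempty (Msg N ρ) :=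
  ⟨⟨0, one_le_card_msg N hρ⟩⟩

theorem card_messages_pos (N : ℕ) (h₁ : ∀ i, 0 ≤ r.1 i) (h₂ : ∀ i v, 0 ≤ r.2 i v) :
    0 < Fintype.card (Messages N r) := by
  have := fun i => nonempty_msg N (h₁ i)
  have := fun i v => nonempty_msg N (h₂ i v)
  exact Fintype.card_pos

theorem stateLaw_mul_card_le_prob (hp0 : 0 < p) (hp1 : p < 1) (κ : StateModel)
    (hM : 0 < Fintype.card (Messages N r)) (E : Messages N r → States → Prop) (b : States)
    (S : Finset (Messages N r)) (hS : ∀ w ∈ S, E w b) :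
    stateLaw p κ b * S.card ≤ Fintype.card (Messages N r) * prob p κ N r E := by
  classical
  have hM' : (0 : ℝ) < Fintype.card (Messages N r) := by exact_mod_cast hM
  have hb := stateLaw_nonneg hp0 hp1 κ
  have key : ∑ w ∈ S, (Fintype.card (Messages N r) : ℝ)⁻¹ * stateLaw p κ b ≤
      prob p κ N r E := by
    refine le_trans (Finset.sum_le_sum fun w hw => ?_)
      (Finset.sum_le_univ_sum_of_nonneg fun w => Finset.sum_nonneg fun b _ => ?_)
    · refine le_trans (le_of_eq ?_) (Finset.single_le_sum (fun b' _ => ?_) (Finset.mem_univ b))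
      · rw [if_pos (hS w hw)]
      · have := hb b'
        positivity
    · have := hb b
      positivity
  rw [Finset.sum_const, nsmul_eq_mul] at key
  calc _ = Fintype.card (Messages N r) * ((S.card : ℝ) *
        ((Fintype.card (Messages N r) : ℝ)⁻¹ * stateLaw p κ b)) := by
        field_simp
    _ ≤ _ := by gcongr

theorem prob_le_one (hp0 : 0 < p) (hp1 : p < 1) (κ : StateModel)
    (hM : 0 < Fintype.card (Messages N r)) (E : Messages N r → States → Prop) :
    prob p κ N r E ≤ 1 := by
  classical
  have hM' : (0 : ℝ) < Fintype.card (Messages N r) := by exact_mod_cast hM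
  calc prob p κ N r E ≤ ∑ _w : Messages N r, ∑ b : States,
        (Fintype.card (Messages N r) : ℝ)⁻¹ * stateLaw p κ b := by
        refine Finset.sum_le_sum fun w _ => Finset.sum_le_sum fun b _ => ?_
        have := stateLaw_nonneg hp0 hp1 κ b
        split_ifs
        · exact le_rfl
        · positivity
    _ = 1 := by
        simp only [← Finset.mul_sum, sum_stateLaw, Finset.sum_const, Finset.card_univ,
          nsmul_eq_mul]
        field_simp

/-- Receiver `i` decodes the messages for its state correctly when `w` is sent in state `b`. -/
def OppCode.Correct (C : OppCode nd nc c N r) (b : States) (i : Fin 2) (w : Messages N r) : Prop :=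
  C.decoded w b i = ((w i).1, (w i).2 (b i))

open Classical in
theorem card_not_correct_le (hp0 : 0 < p) (hp1 : p < 1) (κ : StateModel)
    (hM : 0 < Fintype.card (Messages N r)) (C : OppCode nd nc c N r) (b : States) (i : Fin 2)
    (hb : 0 < stateLaw p κ b) :
    stateLaw p κ b * (Finset.univ.filter fun w => ¬ C.Correct b i w).card ≤
      Fintype.card (Messages N r) * C.oppErr p κ i (b i) := by
  have h := stateLaw_mul_card_le_prob hp0 hp1 κ hM
    (fun w b' => b' i = b i ∧ C.decoded w b' i ≠ ((w i).1, (w i).2 (b' i))) b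
    (Finset.univ.filter fun w => ¬ C.Correct b i w)
    (fun w hw => ⟨rfl, (Finset.mem_filter.1 hw).2⟩)
  refine h.trans (mul_le_mul_of_nonneg_left ?_ (Nat.cast_nonneg _))
  have hM' : (0 : ℝ) < Fintype.card (Messages N r) := by exact_mod_cast hM
  have hden : 0 < prob p κ N r (fun _ b' => b' i = b i) := by
    have h' := stateLaw_mul_card_le_prob hp0 hp1 κ hM (fun _ b' => b' i = b i) b
      Finset.univ (fun _ _ => rfl)
    rw [Finset.card_univ] at h'
    have h2 : 0 < stateLaw p κ b * Fintype.card (Messages N r) := by positivity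
    exact pos_of_mul_pos_right (h2.trans_le h') hM'.le
  refine le_div_self ?_ hden (prob_le_one hp0 hp1 κ hM _)
  have h0 : 0 ≤ stateLaw p κ b *
      ((Finset.univ.filter fun w => ¬ C.Correct b i w).card : ℝ) := by positivity
  exact nonneg_of_mul_nonneg_right (h0.trans h) hM'

open Classical in
/-- In every state the receivers of a reliable sequence of codes decode correctly for all but a
vanishing fraction of the messages. States of probability zero are included: they only occur for
fully correlated states, where under local CSIR what receiver `i` sees depends on `b i` alone. -/
theorem eventually_card_not_correct_le (hp0 : 0 < p) (hp1 : p < 1) {κ : StateModel}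
    (hκ : κ = .independent ∨ c = .localCSIR) (h₁ : ∀ i, 0 ≤ r.1 i) (h₂ : ∀ i v, 0 ≤ r.2 i v)
    (C : (N : ℕ) → OppCode nd nc c N r)
    (hC : ∀ i v, Tendsto (fun N => (C N).oppErr p κ i v) atTop (𝓝 0))
    (b : States) (i : Fin 2) {ε : ℝ} (hε : 0 < ε) :
    ∀ᶠ N in atTop, ((Finset.univ.filter fun w => ¬ (C N).Correct b i w).card : ℝ) ≤
      ε * Fintype.card (Messages N r) := by
  have main : ∀ b' : States, 0 < stateLaw p κ b' → ∀ᶠ N in atTop,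
      ((Finset.univ.filter fun w => ¬ (C N).Correct b' i w).card : ℝ) ≤
        ε * Fintype.card (Messages N r) := by
    intro b' hb'
    filter_upwards [(hC i (b' i)).eventually (gt_mem_nhds (mul_pos hb' hε))] with N hN
    have h := card_not_correct_le hp0 hp1 κ (card_messages_pos N h₁ h₂) (C N) b' i hb'
    have hM' : (0 : ℝ) < Fintype.card (Messages N r) := by
      exact_mod_cast card_messages_pos N h₁ h₂
    refine le_of_mul_le_mul_left ?_ hb'
    nlinarith
  have hind : κ = .independent → 0 < stateLaw p κ b := by
    rintro rfl
    exact mul_pos (bern_pos hp0 hp1 _) (bern_pos hp0 hp1 _)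
  rcases hκ with hκ | rfl
  · exact main b (hind hκ)
  · cases κ
    · exact main b (hind rfl)
    · have h := main (fun _ => b i) (by simpa [stateLaw] using bern_pos hp0 hp1 (b i))
      exact h

end Errors

/-! ### Bounds on the numbers of messages -/

section Converse

variable {nd nc : ℕ} {c : CSI} {N : ℕ} {r : RateTuple}

/-- The channel input of user `i` when `w` is sent in state `b`. -/
def OppCode.input (C : OppCode nd nc c N r) (b : States) (i : Fin 2) (w : Messages N r) :
    Block nd nc N :=
  C.enc i (w i) (txInfo c (b i))

theorem OppCode.input_congr (C : OppCode nd nc c N r) (b : States) {i : Fin 2}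
    {w w' : Messages N r} (h : w i = w' i) : C.input b i w = C.input b i w' := by
  rw [input, input, h]

/-- The channel output of receiver `i` when `w` is sent in state `b`. -/
def OppCode.received (C : OppCode nd nc c N r) (b : States) (i : Fin 2) (w : Messages N r) :
    Block nd nc N :=
  output nd nc N (fun j => C.input b j w) b i

theorem OppCode.received_of_false (C : OppCode nd nc c N r) {b : States} {i : Fin 2}
    (hb : b i = false) (w : Messages N r) :
    C.received b i w = shift (max nd nc) nd * C.input b i w := by
  simp [received, output, hb]

theorem OppCode.received_of_true (C : OppCode nd nc c N r) {b : States} {i : Fin 2}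
    (hb : b i = true) (w : Messages N r) :
    C.received b i w = shift (max nd nc) nd * C.input b i w +
      shift (max nd nc) nc * C.input b (1 - i) w := by
  simp [received, output, hb]

theorem OppCode.Correct.eq_of_received_eq {C : OppCode nd nc c N r} {b : States} {i : Fin 2}
    {w w' : Messages N r} (h : C.Correct b i w) (h' : C.Correct b i w')
    (hy : C.received b i w = C.received b i w') :
    (w i).1 = (w' i).1 ∧ (w i).2 (b i) = (w' i).2 (b i) := by
  have e : C.decoded w b i = C.decoded w' b i :=
    congrArg (fun y => C.dec i y (b i)) hy
  rw [h, h', Prod.mk.injEq] at e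
  exact e

theorem userMsg_ext {i : Fin 2} {m m' : UserMsg N r i} (h : m.1 = m'.1)
    (hf : m.2 false = m'.2 false) (ht : m.2 true = m'.2 true) : m = m' :=
  Prod.ext h (funext fun v => by cases v <;> assumption)

theorem messages_ext {i : Fin 2} {w w' : Messages N r} (h : w i = w' i)
    (h' : w (1 - i) = w' (1 - i)) : w = w' := by
  funext j
  fin_cases i <;> fin_cases j <;> first | exact h | exact h'

theorem card_messages (i : Fin 2) : Fintype.card (Messages N r) =
    Fintype.card (UserMsg N r i) * Fintype.card (UserMsg N r (1 - i)) := by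
  rw [Fintype.card_pi, Fin.prod_univ_two]
  fin_cases i
  · rfl
  · exact mul_comm _ _

theorem card_userMsg (i : Fin 2) : Fintype.card (UserMsg N r i) =
    Fintype.card (Msg N (r.1 i)) * (Fintype.card (Msg N (r.2 i true)) *
      Fintype.card (Msg N (r.2 i false))) := by
  rw [Fintype.card_prod, Fintype.card_pi, Fintype.prod_bool]

theorem card_userMsg' (i : Fin 2) : Fintype.card (UserMsg N r i) =
    Fintype.card (Msg N (r.1 i)) * Fintype.card ((v : Bool) → Msg N (r.2 i v)) :=
  Fintype.card_prod _ _

/-- If receiver `i` decodes half of all messages correctly in the absence of interference, its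
messages for this state number at most twice the outputs. -/
theorem card_single_user_le (C : OppCode nd nc c N r)
    (hM : 0 < Fintype.card (Messages N r)) {b : States} {i : Fin 2}
    (hb : b i = false) (G : Finset (Messages N r)) (hG : ∀ w ∈ G, C.Correct b i w)
    (hcard : Fintype.card (Messages N r) ≤ 2 * G.card) :
    Fintype.card (Msg N (r.1 i)) * Fintype.card (Msg N (r.2 i false)) ≤
      2 * 2 ^ (N * nd) := by
  have hle : G.card ≤ Fintype.card ((Fin nd → Fin N → ZMod 2) ×
      (Msg N (r.2 i true) × UserMsg N r (1 - i))) := by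
    rw [← Finset.card_univ]
    refine Finset.card_le_card_of_injOn (fun w => (fun k t => rowOf (C.input b i w) k t,
      (w i).2 true, w (1 - i))) (fun _ _ => Finset.mem_coe.2 (Finset.mem_univ _)) ?_
    intro w hw w' hw' h
    simp only [Prod.mk.injEq] at h
    obtain ⟨hrow, hΔ, hj⟩ := h
    have hy : C.received b i w = C.received b i w' := by
      rw [C.received_of_false hb, C.received_of_false hb,
        shift_mul_eq_iff (le_max_left nd nc)]
      exact fun k hk t => congrFun (congrFun hrow ⟨k, hk⟩) t
    obtain ⟨h1, h2⟩ := (hG w hw).eq_of_received_eq (hG w' hw') hy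
    rw [hb] at h2
    exact messages_ext (userMsg_ext h1 h2 hΔ) hj
  have hcm := card_messages (N := N) (r := r) i
  rw [card_userMsg i] at hcm
  rw [Fintype.card_prod, Fintype.card_prod, Fintype.card_fun, Fintype.card_fun, ZMod.card,
    Fintype.card_fin N, Fintype.card_fin nd, ← pow_mul] at hle
  set A := Fintype.card (Msg N (r.1 i))
  set Dt := Fintype.card (Msg N (r.2 i true))
  set Df := Fintype.card (Msg N (r.2 i false))
  set U := Fintype.card (UserMsg N r (1 - i))
  have hpos : 0 < Dt * U := Nat.pos_of_ne_zero fun h0 => hM.ne' (by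
    rw [hcm, show A * (Dt * Df) * U = A * Df * (Dt * U) by ring, h0, mul_zero])
  refine Nat.le_of_mul_le_mul_right (c := Dt * U) ?_ hpos
  calc A * Df * (Dt * U) = A * (Dt * Df) * U := by ring
    _ ≤ 2 * (2 ^ (N * nd) * (Dt * U)) := by
        rw [← hcm]
        exact hcard.trans (Nat.mul_le_mul_left 2 hle)
    _ = _ := by ring

/-- Let user `i` be free of interference and let the other user suffer from it. The output of the
other receiver, together with the rows of the input of user `i` that this receiver does not see,
determines the worst-case messages and the opportunistic message of user `i`. -/
theorem card_one_interfered_le (C : OppCode nd nc c N r)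
    (hM : 0 < Fintype.card (Messages N r)) {b : States} {i : Fin 2}
    (hb : b i = false) (hb' : b (1 - i) = true) (G : Finset (Messages N r))
    (hG : ∀ w ∈ G, C.Correct b i w) (hG' : ∀ w ∈ G, C.Correct b (1 - i) w)
    (hcard : Fintype.card (Messages N r) ≤ 2 * G.card) :
    Fintype.card (Msg N (r.1 i)) * Fintype.card (Msg N (r.1 (1 - i))) *
      Fintype.card (Msg N (r.2 i false)) ≤ 2 * 2 ^ (N * (max nd nc + (nd - nc))) := by
  have hle : G.card ≤ Fintype.card ((Fin (max nd nc) → Fin N → ZMod 2) ×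
      (Fin (nd - nc) → Fin N → ZMod 2) ×
      (Msg N (r.2 i true) × ((v : Bool) → Msg N (r.2 (1 - i) v)))) := by
    rw [← Finset.card_univ]
    refine Finset.card_le_card_of_injOn (fun w => (C.received b (1 - i) w,
      (fun k t => rowOf (C.input b i w) (nc + k) t),
      (w i).2 true, (w (1 - i)).2)) (fun _ _ => Finset.mem_coe.2 (Finset.mem_univ _)) ?_
    intro w hw w' hw' h
    obtain ⟨hyj, h⟩ := Prod.ext_iff.1 h
    obtain ⟨hrow, h⟩ := Prod.ext_iff.1 h
    obtain ⟨hΔ, hj⟩ := Prod.ext_iff.1 h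
    replace hyj : C.received b (1 - i) w = C.received b (1 - i) w' := hyj
    have hwj : w (1 - i) = w' (1 - i) :=
      Prod.ext ((hG' w hw).eq_of_received_eq (hG' w' hw') hyj).1 hj
    have hV : shift (max nd nc) nc * C.input b i w = shift (max nd nc) nc * C.input b i w' := by
      rw [C.received_of_true hb', C.received_of_true hb', C.input_congr b hwj,
        show (1 : Fin 2) - (1 - i) = i by fin_cases i <;> rfl] at hyj
      exact add_left_cancel hyj
    rw [shift_mul_eq_iff (le_max_right nd nc)] at hV
    have hy : C.received b i w = C.received b i w' := by
      rw [C.received_of_false hb, C.received_of_false hb,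
        shift_mul_eq_iff (le_max_left nd nc)]
      intro k hk t
      by_cases hkc : k < nc
      · exact hV k hkc t
      · have := congrFun (congrFun hrow ⟨k - nc, by omega⟩) t
        simpa [Nat.add_sub_cancel' (not_lt.1 hkc)] using this
    obtain ⟨h1, h2⟩ := (hG w hw).eq_of_received_eq (hG w' hw') hy
    rw [hb] at h2
    exact messages_ext (userMsg_ext h1 h2 hΔ) hwj
  have hcm := card_messages (N := N) (r := r) i
  rw [card_userMsg i, card_userMsg' (1 - i)] at hcm
  rw [Fintype.card_prod, Fintype.card_prod, Fintype.card_prod, Fintype.card_fun,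
    Fintype.card_fun, Fintype.card_fun (β := Fin N → ZMod 2), Fintype.card_fun, ZMod.card,
    Fintype.card_fin N, Fintype.card_fin, Fintype.card_fin, ← pow_mul, ← pow_mul] at hle
  set A := Fintype.card (Msg N (r.1 i))
  set A' := Fintype.card (Msg N (r.1 (1 - i)))
  set Dt := Fintype.card (Msg N (r.2 i true))
  set Df := Fintype.card (Msg N (r.2 i false))
  set U := Fintype.card ((v : Bool) → Msg N (r.2 (1 - i) v))
  have hpos : 0 < Dt * U := Nat.pos_of_ne_zero fun h0 => hM.ne' (by
    rw [hcm, show A * (Dt * Df) * (A' * U) = A * Df * A' * (Dt * U) by ring, h0, mul_zero])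
  refine Nat.le_of_mul_le_mul_right (c := Dt * U) ?_ hpos
  calc A * A' * Df * (Dt * U) = A * (Dt * Df) * (A' * U) := by ring
    _ ≤ 2 * (2 ^ (N * max nd nc) * (2 ^ (N * (nd - nc)) * (Dt * U))) := by
        rw [← hcm]
        exact hcard.trans (Nat.mul_le_mul_left 2 hle)
    _ = _ := by rw [mul_add, pow_add]; ring

/-- The rows of an interfered output below the first `min nc (nd - nc)` rows, together with the
interference that the user causes at the other receiver, determine the whole output. -/
theorem interfered_output_eq {q nd nc : ℕ} (hq : q = max nd nc)
    {X X' Z Z' : Matrix (Fin q) (Fin N) (ZMod 2)}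
    (hV : shift q nc * X = shift q nc * X')
    (hrow : ∀ k : Fin (max (nd - nc) nc), ∀ t,
      rowOf (shift q nd * X + shift q nc * Z) (q - max (nd - nc) nc + k) t =
      rowOf (shift q nd * X' + shift q nc * Z') (q - max (nd - nc) nc + k) t) :
    shift q nd * X + shift q nc * Z = shift q nd * X' + shift q nc * Z' := by
  rw [shift_mul_eq_iff (by omega)] at hV
  ext k t
  by_cases hk : (k : ℕ) < q - max (nd - nc) nc
  · rw [Matrix.add_apply, Matrix.add_apply, shift_mul_apply, shift_mul_apply, shift_mul_apply,
      shift_mul_apply, if_neg (show ¬ q - nc ≤ (k : ℕ) by omega),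
      if_neg (show ¬ q - nc ≤ (k : ℕ) by omega), hV _ (by omega) t]
  · have h := hrow ⟨k - (q - max (nd - nc) nc), by have := k.2; omega⟩ t
    have hk' : q - max (nd - nc) nc + ((k : ℕ) - (q - max (nd - nc) nc)) = k := by omega
    simpa only [hk', rowOf, k.2, dif_pos] using h

open Classical in
/-- If both receivers decode correctly under interference for `7/8` of all messages, then the
worst-case messages number at most `16` times `2 ^ (2 * N * max (nd - nc) nc)`. The opportunistic
messages are fixed to values for which the average fraction of correctly decoded worst-case
messages is attained. -/
theorem card_both_interfered_le (C : OppCode nd nc c N r)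
    (h₁ : ∀ i, 0 ≤ r.1 i) (h₂ : ∀ i v, 0 ≤ r.2 i v) {b : States}
    (hb : ∀ i, b i = true) (G : Finset (Messages N r)) (hG : ∀ i, ∀ w ∈ G, C.Correct b i w)
    (hcard : 7 * Fintype.card (Messages N r) ≤ 8 * G.card) :
    Fintype.card (Msg N (r.1 0)) * Fintype.card (Msg N (r.1 1)) ≤
      16 * 2 ^ (N * (2 * max (nd - nc) nc)) := by
  have := nonempty_msg N (h₁ 0)
  have := nonempty_msg N (h₁ 1)
  have := fun i v => nonempty_msg N (h₂ i v)
  let Δ := ((v : Bool) → Msg N (r.2 0 v)) × ((v : Bool) → Msg N (r.2 1 v))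
  let W := Msg N (r.1 0) × Msg N (r.1 1)
  let e : W × Δ ≃ Messages N r :=
    (Equiv.prodProdProdComm _ _ _ _).trans (piFinTwoEquiv (UserMsg N r)).symm
  let H : Δ → Finset W := fun δ => Finset.univ.filter fun w => e (w, δ) ∈ G
  have hsum : ∑ δ, (H δ).card = G.card := by
    rw [← Finset.card_sigma]
    refine Finset.card_bij (fun x _ => e (x.2, x.1)) ?_ ?_ ?_
    · intro x hx
      simpa [H] using hx
    · rintro ⟨δ, w⟩ _ ⟨δ', w'⟩ _ h
      have := e.injective h
      simp only [Prod.mk.injEq] at this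
      obtain ⟨rfl, rfl⟩ := this
      rfl
    · intro m hm
      refine ⟨⟨(e.symm m).2, (e.symm m).1⟩, ?_, ?_⟩
      · simpa [H] using hm
      · simp
  obtain ⟨δ, -, hδ⟩ : ∃ δ ∈ (Finset.univ : Finset Δ),
      7 * (Fintype.card (Msg N (r.1 0)) * Fintype.card (Msg N (r.1 1))) ≤ 8 * (H δ).card := by
    refine Finset.exists_le_of_sum_le Finset.univ_nonempty ?_
    rw [Finset.sum_const, ← Finset.mul_sum, hsum, Finset.card_univ, smul_eq_mul]
    refine le_trans (le_of_eq ?_) hcard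
    rw [← Fintype.card_congr e, Fintype.card_prod W Δ,
      Fintype.card_prod (Msg N (r.1 0)) (Msg N (r.1 1))]
    ring
  have hmem : ∀ w ∈ H δ, e (w, δ) ∈ G := fun w hw => (Finset.mem_filter.1 hw).2
  have e0 : ∀ w : W, e (w, δ) 0 = (w.1, δ.1) := fun _ => rfl
  have e1 : ∀ w : W, e (w, δ) 1 = (w.2, δ.2) := fun _ => rfl
  let x₀ : Msg N (r.1 0) → Block nd nc N := fun w => C.enc 0 (w, δ.1) (txInfo c (b 0))
  let x₁ : Msg N (r.1 1) → Block nd nc N := fun w => C.enc 1 (w, δ.2) (txInfo c (b 1))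
  let T := Fin (max (nd - nc) nc) → Fin N → ZMod 2
  have hy₀ : ∀ w : W, C.received b 0 (e (w, δ)) = shift (max nd nc) nd * x₀ w.1 +
      shift (max nd nc) nc * x₁ w.2 := fun w => C.received_of_true (hb 0) _
  have hy₁ : ∀ w : W, C.received b 1 (e (w, δ)) = shift (max nd nc) nd * x₁ w.2 +
      shift (max nd nc) nc * x₀ w.1 := fun w => C.received_of_true (hb 1) _
  have key := card_mul_card_le (T₁ := T) (T₂ := T)
    (fun w => shift (max nd nc) nc * x₀ w) (fun w => shift (max nd nc) nc * x₁ w)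
    (fun w k t => rowOf (C.received b 0 (e (w, δ))) (max nd nc - max (nd - nc) nc + k) t)
    (fun w k t => rowOf (C.received b 1 (e (w, δ))) (max nd nc - max (nd - nc) nc + k) t)
    (H δ) hδ ?_ ?_
  · refine key.trans (le_of_eq ?_)
    rw [Fintype.card_fun, Fintype.card_fun, ZMod.card, Fintype.card_fin, Fintype.card_fin,
      ← pow_mul, ← pow_add]
    congr 2
    ring
  · intro w hw w' hw' hV hτ
    have hy : C.received b 0 (e (w, δ)) = C.received b 0 (e (w', δ)) := by
      rw [hy₀, hy₀]
      refine interfered_output_eq rfl hV fun k t => ?_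
      have := congrFun (congrFun hτ k) t
      simpa only [hy₀] using this
    have h1 : w.1 = w'.1 := ((hG 0 _ (hmem w hw)).eq_of_received_eq (hG 0 _ (hmem w' hw')) hy).1
    rw [hy₀, hy₀, h1] at hy
    exact ⟨h1, add_left_cancel hy⟩
  · intro w hw w' hw' hV hτ
    have hy : C.received b 1 (e (w, δ)) = C.received b 1 (e (w', δ)) := by
      rw [hy₁, hy₁]
      refine interfered_output_eq rfl hV fun k t => ?_
      have := congrFun (congrFun hτ k) t
      simpa only [hy₁] using this
    have h1 : w.2 = w'.2 := ((hG 1 _ (hmem w hw)).eq_of_received_eq (hG 1 _ (hmem w' hw')) hy).1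
    rw [hy₁, hy₁, h1] at hy
    exact ⟨h1, add_left_cancel hy⟩

end Converse

/-! ### Outer bounds on the capacity region -/

section RateBounds

variable {nd nc : ℕ} {c : CSI} {r : RateTuple} {p : ℝ}

theorem le_of_eventually_rpow_le {s B K : ℝ}
    (h : ∀ᶠ N : ℕ in atTop, (2 : ℝ) ^ ((N : ℝ) * s) ≤ K * 2 ^ ((N : ℝ) * B)) : s ≤ B := by
  by_contra! hlt
  have h1 : (1 : ℝ) < 2 ^ (s - B) := Real.one_lt_rpow (by norm_num) (by linarith)
  obtain ⟨N, hN, hK⟩ :=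
    (h.and ((tendsto_pow_atTop_atTop_of_one_lt h1).eventually_gt_atTop K)).exists
  rw [← Real.rpow_natCast, ← Real.rpow_mul (by norm_num)] at hK
  have h2 : (2 : ℝ) ^ ((N : ℝ) * s) = 2 ^ ((s - B) * (N : ℝ)) * 2 ^ ((N : ℝ) * B) := by
    rw [← Real.rpow_add (by norm_num)]
    ring_nf
  rw [h2] at hN
  exact absurd (le_of_mul_le_mul_right hN (by positivity)) (not_le.2 hK)

theorem rpow_le_two_mul_card_msg (N : ℕ) {ρ : ℝ} (hρ : 0 ≤ ρ) :
    (2 : ℝ) ^ ((N : ℝ) * ρ) ≤ 2 * Fintype.card (Msg N ρ) := by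
  rw [Fintype.card_fin]
  have h1 := Nat.lt_floor_add_one ((2 : ℝ) ^ ((N : ℝ) * ρ))
  have h2 : (1 : ℝ) ≤ ⌊(2 : ℝ) ^ ((N : ℝ) * ρ)⌋₊ := by exact_mod_cast one_le_card_msg N hρ
  linarith

/-- A bound on the numbers of messages for all large block lengths, up to a constant factor,
is a bound on the rates. -/
theorem sum_rates_le_of_card_le {ι : Type*} (s : Finset ι) (ρ : ι → ℝ) (hρ : ∀ i, 0 ≤ ρ i)
    {K B : ℕ} (h : ∀ᶠ N : ℕ in atTop,
      ∏ i ∈ s, Fintype.card (Msg N (ρ i)) ≤ K * 2 ^ (N * B)) :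
    ∑ i ∈ s, ρ i ≤ B := by
  refine le_of_eventually_rpow_le (K := 2 ^ s.card * K) ?_
  filter_upwards [h] with N hN
  rw [Finset.mul_sum, Real.rpow_sum_of_pos (by norm_num)]
  calc ∏ i ∈ s, (2 : ℝ) ^ ((N : ℝ) * ρ i)
      ≤ ∏ i ∈ s, (2 * Fintype.card (Msg N (ρ i)) : ℝ) :=
        Finset.prod_le_prod (fun i _ => by positivity)
          (fun i _ => rpow_le_two_mul_card_msg N (hρ i))
    _ = 2 ^ s.card * ((∏ i ∈ s, Fintype.card (Msg N (ρ i)) : ℕ) : ℝ) := by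
        rw [Finset.prod_mul_distrib, Finset.prod_const, Nat.cast_prod]
    _ ≤ 2 ^ s.card * ((K * 2 ^ (N * B) : ℕ) : ℝ) := by gcongr
    _ = _ := by
        rw [← Nat.cast_mul N B, Real.rpow_natCast]
        push_cast
        ring

open Classical in
theorem eventually_card_correct (hp0 : 0 < p) (hp1 : p < 1) {κ : StateModel}
    (hκ : κ = .independent ∨ c = .localCSIR) (h₁ : ∀ i, 0 ≤ r.1 i) (h₂ : ∀ i v, 0 ≤ r.2 i v)
    (C : (N : ℕ) → OppCode nd nc c N r)
    (hC : ∀ i v, Tendsto (fun N => (C N).oppErr p κ i v) atTop (𝓝 0)) (b : States) :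
    ∀ᶠ N in atTop, 7 * Fintype.card (Messages N r) ≤
      8 * (Finset.univ.filter fun w => ∀ i, (C N).Correct b i w).card := by
  have h := fun i => eventually_card_not_correct_le hp0 hp1 hκ h₁ h₂ C hC b i
    (show (0 : ℝ) < 1 / 16 by norm_num)
  filter_upwards [h 0, h 1] with N h0 h1
  have hcov : Fintype.card (Messages N r) ≤
      (Finset.univ.filter fun w => ∀ i, (C N).Correct b i w).card +
      ((Finset.univ.filter fun w => ¬ (C N).Correct b 0 w).card +
      (Finset.univ.filter fun w => ¬ (C N).Correct b 1 w).card) := by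
    rw [← Finset.card_univ]
    refine le_trans (Finset.card_le_card fun w _ => ?_)
      ((Finset.card_union_le _ _).trans (Nat.add_le_add_left (Finset.card_union_le _ _) _))
    simp only [Finset.mem_union, Finset.mem_filter, Finset.mem_univ, true_and, Fin.forall_fin_two]
    tauto
  have hcov' : (Fintype.card (Messages N r) : ℝ) ≤
      (Finset.univ.filter fun w => ∀ i, (C N).Correct b i w).card +
      ((Finset.univ.filter fun w => ¬ (C N).Correct b 0 w).card +
      (Finset.univ.filter fun w => ¬ (C N).Correct b 1 w).card) := by
    exact_mod_cast hcov
  have : (7 * Fintype.card (Messages N r) : ℝ) ≤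
      8 * (Finset.univ.filter fun w => ∀ i, (C N).Correct b i w).card := by linarith
  exact_mod_cast this

/-- The rate tuples that satisfy the outer bounds, before passing to sum rates. -/
def outerRegion (nd nc : ℕ) : Set RateTuple :=
  {r | (∀ i, 0 ≤ r.1 i) ∧ (∀ i v, 0 ≤ r.2 i v) ∧ (∀ i, r.2 i true = 0) ∧
    (∀ i, r.1 i + r.2 i false ≤ nd) ∧
    (∀ i, r.1 0 + r.1 1 + r.2 i false ≤ ((max nd nc + (nd - nc) : ℕ) : ℝ)) ∧
    r.1 0 + r.1 1 ≤ ((2 * max (nd - nc) nc : ℕ) : ℝ)}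

theorem isClosed_outerRegion (nd nc : ℕ) : IsClosed (outerRegion nd nc) := by
  simp only [outerRegion, Set.ofPred_and, Set.ofPred_forall]
  refine IsClosed.inter ?_ (IsClosed.inter ?_ (IsClosed.inter ?_ (IsClosed.inter ?_
    (IsClosed.inter ?_ ?_))))
  · exact isClosed_iInter fun i => isClosed_le (by fun_prop) (by fun_prop)
  · exact isClosed_iInter fun i => isClosed_iInter fun v =>
      isClosed_le (by fun_prop) (by fun_prop)
  · exact isClosed_iInter fun i => isClosed_eq (by fun_prop) (by fun_prop)
  · exact isClosed_iInter fun i => isClosed_le (by fun_prop) (by fun_prop)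
  · exact isClosed_iInter fun i => isClosed_le (by fun_prop) (by fun_prop)
  · exact isClosed_le (by fun_prop) (by fun_prop)

theorem mem_outerRegion_of_achievable (hp0 : 0 < p) (hp1 : p < 1) {κ : StateModel}
    (hκ : κ = .independent ∨ c = .localCSIR) (h : Achievable nd nc c κ p r) :
    r ∈ outerRegion nd nc := by
  classical
  obtain ⟨h₁, h₂, h₃, C, -, hC⟩ := h
  have hcard := eventually_card_correct hp0 hp1 hκ h₁ h₂ C hC
  have hG : ∀ N b i, ∀ w ∈ Finset.univ.filter fun w => ∀ i, (C N).Correct b i w,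
      (C N).Correct b i w := fun N b i w hw => (Finset.mem_filter.1 hw).2 i
  refine ⟨h₁, h₂, h₃, fun i => ?_, fun i => ?_, ?_⟩
  · have := sum_rates_le_of_card_le (K := 2) (B := nd) Finset.univ ![r.1 i, r.2 i false]
      (by simp [Fin.forall_fin_two, h₁, h₂]) (by
        filter_upwards [hcard fun _ => false] with N hN
        simpa [Fin.prod_univ_two] using card_single_user_le (C N) (card_messages_pos N h₁ h₂)
          (b := fun _ => false) (i := i) rfl _ (hG N _ i) (by omega))
    simpa using this
  · have := sum_rates_le_of_card_le (K := 2) (B := max nd nc + (nd - nc)) Finset.univ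
      ![r.1 i, r.1 (1 - i), r.2 i false]
      (by simp [Fin.forall_fin_succ, h₁, h₂]) (by
        filter_upwards [hcard fun j => decide (j ≠ i)] with N hN
        have := card_one_interfered_le (C N) (card_messages_pos N h₁ h₂)
          (i := i) (b := fun j => decide (j ≠ i)) (by simp) (by fin_cases i <;> simp) _
          (hG N _ i) (hG N _ (1 - i)) (by omega)
        simpa [Fin.prod_univ_three] using this)
    rw [Fin.sum_univ_three] at this
    fin_cases i
    · exact this
    · rw [add_comm (r.1 0)]
      exact this
  · have := sum_rates_le_of_card_le (K := 16) (B := 2 * max (nd - nc) nc) Finset.univ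
      ![r.1 0, r.1 1] (by simp [Fin.forall_fin_two, h₁]) (by
        filter_upwards [hcard fun _ => true] with N hN
        simpa [Fin.prod_univ_two] using card_both_interfered_le (C N) h₁ h₂
          (b := fun _ => true) (fun _ => rfl) _ (hG N _) hN)
    simpa using this

theorem cast_tsub_eq_max (m n : ℕ) : ((m - n : ℕ) : ℝ) = max ((m : ℝ) - n) 0 := by
  rcases le_total n m with h | h
  · rw [Nat.cast_sub h, max_eq_left (sub_nonneg.2 (by exact_mod_cast h))]
  · rw [Nat.sub_eq_zero_of_le h, Nat.cast_zero,
      max_eq_right (sub_nonpos.2 (by exact_mod_cast h))]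

theorem sumRates_mem_boundRegion (h : r ∈ outerRegion nd nc) : sumRates r ∈ boundRegion nd nc := by
  obtain ⟨h₁, h₂, h₃, hs, hz, ht⟩ := h
  push_cast [cast_tsub_eq_max] at hz ht
  refine ⟨r.1 0 + r.1 1, r.2, rfl, add_nonneg (h₁ 0) (h₁ 1), fun i => h₂ i false, h₃, ?_, ?_,
    ht, ?_, ?_, ?_⟩
  · linarith [hs 0, hs 1, h₂ 0 false, h₂ 1 false]
  · linarith [hz 0, h₂ 0 false]
  · linarith [hs 0, hs 1]
  · exact fun i => by linarith [hz i]
  · exact fun i => by linarith [hs i, h₁ i]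

theorem oppSumCapacityRegion_subset (hp0 : 0 < p) (hp1 : p < 1) {κ : StateModel}
    (hκ : κ = .independent ∨ c = .localCSIR) :
    oppSumCapacityRegion nd nc c κ p ⊆ boundRegion nd nc := by
  rintro _ ⟨r, hr, rfl⟩
  exact sumRates_mem_boundRegion (closure_minimal
    (fun r hr => mem_outerRegion_of_achievable hp0 hp1 hκ hr) (isClosed_outerRegion nd nc) hr)

end RateBounds

/-! ### Zero-error codes on bits -/

section ZeroErrorCodes

variable {nd nc : ℕ}

/-- What receiver `i` sees on level `l` in one channel use if user `i` sends the bits `x` and the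
other user the bits `z`, in state `v`. The levels are indexed by all of `ℕ`. -/
def levelOutput (nd nc : ℕ) (v : Bool) (x z : ℕ → ZMod 2) (l : ℕ) : ZMod 2 :=
  (if max nd nc - nd ≤ l then x (l - (max nd nc - nd)) else 0) +
    (if v = true ∧ max nd nc - nc ≤ l then z (l - (max nd nc - nc)) else 0)

/-- There are encoders of block length `N`, mapping the bits of user `i` to inputs indexed by
time and level, such that the output of receiver `i` determines the first `k i` bits of user `i`
in the absence of interference and the first `a i` bits in its presence. Hence `a i` bits can
carry the worst-case message and `k i - a i` bits the opportunistic message for state `0`; that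
worst-case bits may be used as opportunistic bits amounts to monotonicity in `a`. -/
def HasZeroErrorCode (nd nc N : ℕ) (a k : Fin 2 → ℕ) : Prop :=
  (∀ i, a i ≤ k i) ∧ ∃ e : Fin 2 → (ℕ → ZMod 2) → ℕ → ℕ → ZMod 2,
    ∀ (m m' : Fin 2 → ℕ → ZMod 2) (i : Fin 2) (v : Bool),
      (∀ t < N, ∀ l < max nd nc,
        levelOutput nd nc v (e i (m i) t) (e (1 - i) (m (1 - i)) t) l =
        levelOutput nd nc v (e i (m' i) t) (e (1 - i) (m' (1 - i)) t) l) →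
      ∀ j < if v then a i else k i, m i j = m' i j

theorem HasZeroErrorCode.mono {N : ℕ} {a k a' k' : Fin 2 → ℕ}
    (h : HasZeroErrorCode nd nc N a k) (ha : ∀ i, a' i ≤ a i) (hk : ∀ i, k' i ≤ k i)
    (hak : ∀ i, a' i ≤ k' i) : HasZeroErrorCode nd nc N a' k' := by
  obtain ⟨-, e, he⟩ := h
  refine ⟨hak, e, fun m m' i v h j hj => he m m' i v h j (hj.trans_le ?_)⟩
  cases v
  · exact hk i
  · exact ha i

theorem hasZeroErrorCode_zero : HasZeroErrorCode nd nc 0 0 0 :=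
  ⟨fun _ => le_rfl, 0, fun _ _ _ v _ _ hj => by cases v <;> exact absurd hj (Nat.not_lt_zero _)⟩

/-- Concatenation of codes. The worst-case bits of the concatenation are the worst-case bits of
the first code followed by those of the second; after them come the remaining bits of the two
codes. -/
theorem HasZeroErrorCode.add {N N' : ℕ} {a k a' k' : Fin 2 → ℕ}
    (h : HasZeroErrorCode nd nc N a k) (h' : HasZeroErrorCode nd nc N' a' k') :
    HasZeroErrorCode nd nc (N + N') (a + a') (k + k') := by
  obtain ⟨hak, e, he⟩ := h
  obtain ⟨hak', e', he'⟩ := h'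
  refine ⟨fun i => Nat.add_le_add (hak i) (hak' i), fun i m t =>
    if t < N then e i (fun j => m (if j < a i then j else j + a' i)) t
    else e' i (fun j => m (if j < a' i then a i + j else k i + j)) (t - N), ?_⟩
  intro m m' i v hm j hj
  have h₁ := he (fun i j => m i (if j < a i then j else j + a' i))
    (fun i j => m' i (if j < a i then j else j + a' i)) i v (fun t ht l hl => by
      simpa only [if_pos ht] using hm t (by omega) l hl)
  have h₂ := he' (fun i j => m i (if j < a' i then a i + j else k i + j))
    (fun i j => m' i (if j < a' i then a i + j else k i + j)) i v (fun t ht l hl => by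
      have := hm (N + t) (by omega) l hl
      simpa only [if_neg (show ¬ N + t < N by omega), Nat.add_sub_cancel_left] using this)
  have hle := hak i
  have hle' := hak' i
  cases v
  · simp only [Bool.false_eq_true, if_false, Pi.add_apply] at hj h₁ h₂
    by_cases c₁ : j < a i
    · simpa only [if_pos c₁] using h₁ j (by omega)
    by_cases c₂ : j < a i + a' i
    · have := h₂ (j - a i) (by omega)
      rwa [if_pos (by omega), Nat.add_sub_cancel' (by omega)] at this
    by_cases c₃ : j < a' i + k i
    · have := h₁ (j - a' i) (by omega)
      rwa [if_neg (by omega), Nat.sub_add_cancel (by omega)] at this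
    · have := h₂ (j - k i) (by omega)
      rwa [if_neg (by omega), Nat.add_sub_cancel' (by omega)] at this
  · simp only [if_true, Pi.add_apply] at hj h₁ h₂
    by_cases c₁ : j < a i
    · simpa only [if_pos c₁] using h₁ j c₁
    · have := h₂ (j - a i) (by omega)
      rwa [if_pos (by omega), Nat.add_sub_cancel' (by omega)] at this

theorem HasZeroErrorCode.nsmul {a k : Fin 2 → ℕ} (h : HasZeroErrorCode nd nc 1 a k) (n : ℕ) :
    HasZeroErrorCode nd nc n (n • a) (n • k) := by
  induction n with
  | zero => simpa using hasZeroErrorCode_zero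
  | succ n ih => simpa only [succ_nsmul] using ih.add h

theorem hasZeroErrorCode_one {a₀ a₁ k₀ k₁ : ℕ} (g₀ g₁ : (ℕ → ZMod 2) → ℕ → ZMod 2)
    (hak₀ : a₀ ≤ k₀) (hak₁ : a₁ ≤ k₁)
    (h₀ : ∀ (x x' z z' : ℕ → ZMod 2) (v : Bool), (∀ l < max nd nc,
      levelOutput nd nc v (g₀ x) (g₁ z) l = levelOutput nd nc v (g₀ x') (g₁ z') l) →
      ∀ j < if v then a₀ else k₀, x j = x' j)
    (h₁ : ∀ (x x' z z' : ℕ → ZMod 2) (v : Bool), (∀ l < max nd nc,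
      levelOutput nd nc v (g₁ x) (g₀ z) l = levelOutput nd nc v (g₁ x') (g₀ z') l) →
      ∀ j < if v then a₁ else k₁, x j = x' j) :
    HasZeroErrorCode nd nc 1 ![a₀, a₁] ![k₀, k₁] := by
  refine ⟨by simp [Fin.forall_fin_two, hak₀, hak₁], fun i m _ => ![g₀, g₁] i m, ?_⟩
  intro m m' i v h
  replace h := h 0 Nat.one_pos
  fin_cases i
  · exact h₀ (m 0) (m' 0) (m 1) (m' 1) v h
  · exact h₁ (m 1) (m' 1) (m 0) (m' 0) v h

theorem hasZeroErrorCode_one_symm {a k : ℕ} (g : (ℕ → ZMod 2) → ℕ → ZMod 2) (hak : a ≤ k)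
    (h : ∀ (x x' z z' : ℕ → ZMod 2) (v : Bool), (∀ l < max nd nc,
      levelOutput nd nc v (g x) (g z) l = levelOutput nd nc v (g x') (g z') l) →
      ∀ j < if v then a else k, x j = x' j) :
    HasZeroErrorCode nd nc 1 ![a, a] ![k, k] :=
  hasZeroErrorCode_one g g hak hak h h

end ZeroErrorCodes

/-! ### Codes for a single channel use -/

section Schemes

theorem levelOutput_weak (c s : ℕ) (v : Bool) (x z : ℕ → ZMod 2) (l : ℕ) :
    levelOutput (c + s) c v x z l = x l + if v = true ∧ s ≤ l then z (l - s) else 0 := by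
  simp [levelOutput]

theorem levelOutput_strong (n s : ℕ) (v : Bool) (x z : ℕ → ZMod 2) (l : ℕ) :
    levelOutput n (n + s) v x z l = (if s ≤ l then x (l - s) else 0) +
      if v = true then z l else 0 := by
  simp [levelOutput]

/-- For `nd = c + s` and `nc = c`, the upper `s` levels of a receiver are free of interference.
They carry the worst-case bits; all others carry opportunistic bits. -/
theorem hasZeroErrorCode_weak (c s : ℕ) :
    HasZeroErrorCode (c + s) c 1 ![s, s] ![c + s, c + s] := by
  refine hasZeroErrorCode_one_symm (fun m => m) (by omega) ?_
  intro x x' z z' v h j hj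
  have hq : max (c + s) c = c + s := by omega
  simp only [hq, levelOutput_weak] at h
  have := h j (by grind)
  grind -ring

/-- For `1/2 ≤ nc / nd ≤ 2/3`, each user keeps the levels `s, …, c - 1` silent. The interference
caused by its levels `0, …, s - 1` meets the other user's levels `s, …, 2 * s - 1`, of which those
from `c` on carry opportunistic bits; the lowest levels of a receiver stay clean. -/
theorem hasZeroErrorCode_moderate {c s : ℕ} (h₁ : s ≤ c) (h₂ : c ≤ 2 * s) :
    HasZeroErrorCode (c + s) c 1 ![c, c] ![2 * s, 2 * s] := by
  refine hasZeroErrorCode_one_symm (fun m l => if l < s then m l else if l < c then 0 else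
    if l < 2 * s then m l else m (l - s)) h₂ ?_
  intro x x' z z' v h j hj
  have hq : max (c + s) c = c + s := by omega
  simp only [hq, levelOutput_weak] at h
  by_cases hjs : j < s ∨ c ≤ j
  · have := h j (by grind)
    grind -ring
  · have := h (j + s) (by omega)
    grind -ring

/-- For `2/3 ≤ nc / nd ≤ 1`, a corner point of the capacity region of the interference channel.
User `1` sends on the upper and on the lower `s` levels. User `0` repeats some of its bits that
meet the interference of user `1` on levels that do not; receiver `1` learns these bits on levels
on which user `1` is silent, and cancels their repetition. -/
theorem hasZeroErrorCode_high {c s : ℕ} (hsc : 2 * s ≤ c) :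
    HasZeroErrorCode (c + s) c 1 ![c, 2 * s] ![c, 2 * s] := by
  obtain ⟨L, hL⟩ : ∃ L, L = min s (c - 2 * s) := ⟨_, rfl⟩
  have hq : max (c + s) c = c + s := by omega
  refine hasZeroErrorCode_one
    (fun m l => if l < c - s then m l else if l < c - L then 0 else
      if l < c then m (l - (c - L) + s) else m (l - s))
    (fun m l => if l < s then m l else if l < c then 0 else m (l - c + s)) le_rfl le_rfl ?_ ?_
  · intro x x' z z' v h j hj
    simp only [hq, levelOutput_weak] at h
    rw [ite_self] at hj
    by_cases h1 : j < c - s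
    · by_cases h2 : v = true ∧ s ≤ j ∧ j < 2 * s
      · have := h (c - L + (j - s)) (by omega)
        grind -ring
      · have := h j (by omega)
        grind -ring
    · have := h (j + s) (by omega)
      grind -ring
  · intro x x' z z' v h j hj
    simp only [hq, levelOutput_weak] at h
    rw [ite_self] at hj
    by_cases h1 : j < s
    · have := h j (by omega)
      grind -ring
    · obtain ⟨d, rfl⟩ := Nat.exists_eq_add_of_le (not_lt.1 h1)
      have e := h (c + d) (by omega)
      by_cases h2 : v = true ∧ s + (c - L) ≤ c + d
      · obtain ⟨t, ht⟩ := Nat.exists_eq_add_of_le h2.2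
        have hz : z (t + s) = z' (t + s) := by
          have := h (t + s + s) (by omega)
          clear h e
          grind -ring
        simp only [show ¬ c + d < s by omega, show ¬ c + d < c by omega, h2.1,
          show s ≤ c + d by omega, show ¬ c + d - s < c - s by omega,
          show ¬ c + d - s < c - L by omega, show c + d - s < c by omega, true_and, if_true,
          if_false, show c + d - s - (c - L) + s = t + s by omega,
          show c + d - c + s = s + d by omega, hz] at e
        exact add_right_cancel e
      · clear h
        grind -ring

/-- For `nd = n` and `nc = n + s`, the lower `s` levels of a receiver are free of interference
provided that the levels of a transmitter that its own receiver does not see are silent. They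
carry the worst-case bits. -/
theorem hasZeroErrorCode_strong (n s : ℕ) :
    HasZeroErrorCode n (n + s) 1 ![min n s, min n s] ![n, n] := by
  obtain ⟨a, ha⟩ : ∃ a, a = min n s := ⟨_, rfl⟩
  have hq : max n (n + s) = n + s := by omega
  rw [← ha]
  refine hasZeroErrorCode_one_symm (fun m l => if l < n - a then m (l + a) else
    if l < n then m (l - (n - a)) else 0) (by omega) ?_
  intro x x' z z' v h j hj
  simp only [hq, levelOutput_strong] at h
  by_cases hja : j < a
  · have := h (n - a + j + s) (by omega)
    grind -ring
  · have := h (j - a + s) (by grind)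
    grind -ring

/-- For `1 ≤ nc / nd ≤ 2`, a corner point of the capacity region of the interference channel.
User `0` sends on all levels that its receiver sees, user `1` on the lower `s` of them, and repeats
some of its bits on the upper levels, where receiver `0` sees them without its own signal and can
cancel them elsewhere. -/
theorem hasZeroErrorCode_strong_corner {n s : ℕ} (hsn : s ≤ n) :
    HasZeroErrorCode n (n + s) 1 ![n, s] ![n, s] := by
  obtain ⟨L, hL⟩ : ∃ L, L = min (n - s) s := ⟨_, rfl⟩
  have hq : max n (n + s) = n + s := by omega
  refine hasZeroErrorCode_one (fun m l => if l < n then m l else 0)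
    (fun m l => if l < L then m (s - L + l) else if l < n - s then 0 else
      if l < n then m (l - (n - s)) else 0) le_rfl le_rfl ?_ ?_
  · intro x x' z z' v h j hj
    simp only [hq, levelOutput_strong] at h
    rw [ite_self] at hj
    have e := h (j + s) (by omega)
    by_cases h1 : v = true ∧ n - s ≤ j + s ∧ j + s < n
    · obtain ⟨t, ht⟩ := Nat.exists_eq_add_of_le h1.2.1
      have hz : z t = z' t := by
        obtain ⟨d, rfl⟩ : ∃ d, t = s - L + d := Nat.exists_eq_add_of_le (by omega)
        have := h d (by omega)
        clear h e
        grind -ring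
      simp only [show s ≤ j + s by omega, show j < n from hj, h1.1,
        show ¬ j + s < L by omega, show ¬ j + s < n - s by omega, h1.2.2, if_true, if_false,
        show j + s - s = j by omega, show j + s - (n - s) = t by omega, hz] at e
      exact add_right_cancel e
    · clear h
      grind -ring
  · intro x x' z z' v h j hj
    simp only [hq, levelOutput_strong] at h
    rw [ite_self] at hj
    have := h (n + j) (by omega)
    grind -ring

end Schemes

/-! ### From zero-error codes to the capacity region -/

section Achievability

variable {nd nc : ℕ} {c : CSI} {N : ℕ} {r : RateTuple} {p : ℝ}

/-- The binary digits of `w`, as elements of `ZMod 2`. -/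
def bits (w j : ℕ) : ZMod 2 := if w.testBit j then 1 else 0

theorem eq_of_bits_eq {n w w' : ℕ} (hw : w < 2 ^ n) (hw' : w' < 2 ^ n)
    (h : ∀ j < n, bits w j = bits w' j) : w = w' := by
  refine Nat.eq_of_testBit_eq fun j => ?_
  by_cases hj : j < n
  · have := h j hj
    simp only [bits] at this
    split_ifs at this <;> simp_all
  · have hle : 2 ^ n ≤ 2 ^ j := Nat.pow_le_pow_right (by norm_num) (not_lt.1 hj)
    rw [Nat.testBit_lt_two_pow (hw.trans_le hle), Nat.testBit_lt_two_pow (hw'.trans_le hle)]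

/-- The first `n` binary digits of `w`, followed by the binary digits of `d`. -/
def joinBits (n w d j : ℕ) : ZMod 2 := if j < n then bits w j else bits d (j - n)

theorem msg_lt_two_pow {ρ : ℝ} (w : Msg N ρ) : (w : ℕ) < 2 ^ ⌈(N : ℝ) * ρ⌉₊ := by
  have h1 : ((w : ℕ) : ℝ) < (2 : ℝ) ^ ((N : ℝ) * ρ) :=
    (Nat.cast_lt.2 w.2).trans_le (Nat.floor_le (by positivity))
  have h2 : (2 : ℝ) ^ ((N : ℝ) * ρ) ≤ (2 : ℝ) ^ ((⌈(N : ℝ) * ρ⌉₊ : ℕ) : ℝ) :=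
    Real.rpow_le_rpow_of_exponent_le (by norm_num) (Nat.le_ceil _)
  rw [Real.rpow_natCast] at h2
  exact_mod_cast h1.trans_le h2

theorem subsingleton_msg {ρ : ℝ} (hρ : ρ = 0) : Subsingleton (Msg N ρ) := by
  subst hρ
  have : ⌊(2 : ℝ) ^ ((N : ℝ) * 0)⌋₊ = 1 := by simp
  rw [Msg, this]
  infer_instance

theorem output_apply (e : Fin 2 → ℕ → ℕ → ZMod 2) (b : States) (i : Fin 2)
    (l : Fin (max nd nc)) (t : Fin N) :
    output nd nc N (fun j => Matrix.of fun l t => e j t l) b i l t =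
      levelOutput nd nc (b i) (e i t) (e (1 - i) t) l := by
  have h : ∀ (j : Fin 2) (u : ℕ), rowOf (Matrix.of fun (l : Fin (max nd nc)) (t : Fin N) =>
      e j t l) (l - u) t = e j t (l - u) := fun j u => dif_pos (by omega)
  simp only [output, levelOutput, Matrix.add_apply, Matrix.smul_apply, shift_mul_apply, h]
  cases b i <;> simp

/-- A zero-error code on bits yields a code for the message sets that never errs. -/
theorem exists_code_decoded_eq (h₁ : ∀ i, 0 ≤ r.1 i) (h₂ : ∀ i v, 0 ≤ r.2 i v)
    (h₃ : ∀ i, r.2 i true = 0)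
    (h : HasZeroErrorCode nd nc N (fun i => ⌈(N : ℝ) * r.1 i⌉₊)
      (fun i => ⌈(N : ℝ) * r.1 i⌉₊ + ⌈(N : ℝ) * r.2 i false⌉₊)) :
    ∃ C : OppCode nd nc c N r, ∀ w b i, C.decoded w b i = ((w i).1, (w i).2 (b i)) := by
  classical
  obtain ⟨-, e, he⟩ := h
  let f : (i : Fin 2) → UserMsg N r i → ℕ → ZMod 2 := fun i w =>
    joinBits ⌈(N : ℝ) * r.1 i⌉₊ w.1 (w.2 false)
  let x : Messages N r → Fin 2 → Block nd nc N := fun w j =>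
    Matrix.of fun l t => e j (f j (w j)) t l
  have key : ∀ (w w' : Messages N r) (b b' : States) (i : Fin 2), b i = b' i →
      output nd nc N (x w) b i = output nd nc N (x w') b' i →
      (w i).1 = (w' i).1 ∧ (w i).2 (b i) = (w' i).2 (b i) := by
    intro w w' b b' i hb hy
    have hbits := he (fun j => f j (w j)) (fun j => f j (w' j)) i (b i) (fun t ht l hl => by
      have := congrFun (congrFun hy ⟨l, hl⟩) ⟨t, ht⟩
      simpa only [x, output_apply (fun j => e j (f j (w j))),
        output_apply (fun j => e j (f j (w' j))), ← hb] using this)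
    have hW : (w i).1 = (w' i).1 := by
      refine Fin.ext (eq_of_bits_eq (msg_lt_two_pow _) (msg_lt_two_pow _) fun j hj => ?_)
      have := hbits j (by split_ifs <;> simp only <;> omega)
      simpa only [f, joinBits, if_pos hj] using this
    refine ⟨hW, ?_⟩
    cases hbi : b i
    · refine Fin.ext (eq_of_bits_eq (msg_lt_two_pow _) (msg_lt_two_pow _) fun j hj => ?_)
      have := hbits (⌈(N : ℝ) * r.1 i⌉₊ + j) (by
        rw [hbi, if_neg (by simp)]
        simp only
        omega)
      simpa only [f, joinBits, if_neg (show ¬ ⌈(N : ℝ) * r.1 i⌉₊ + j < ⌈(N : ℝ) * r.1 i⌉₊ by omega),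
        Nat.add_sub_cancel_left] using this
    · exact (subsingleton_msg (h₃ i)).elim _ _
  have := fun i => nonempty_msg N (h₁ i)
  have := fun i v => nonempty_msg N (h₂ i v)
  -- the decoder picks any messages that are consistent with the output and the state
  let C : OppCode nd nc c N r :=
    { enc := fun i w _ => Matrix.of fun l t => e i (f i w) t l
      dec := fun i y v =>
        if h : ∃ (w : Messages N r) (b : States), b i = v ∧ output nd nc N (x w) b i = y then
          ((h.choose i).1, (h.choose i).2 v)
        else Classical.arbitrary _ }
  refine ⟨C, fun w b i => ?_⟩
  have hex : ∃ (w' : Messages N r) (b' : States), b' i = b i ∧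
      output nd nc N (x w') b' i = output nd nc N (x w) b i := ⟨w, b, rfl, rfl⟩
  have hdec : C.decoded w b i = ((hex.choose i).1, (hex.choose i).2 (b i)) := dif_pos hex
  obtain ⟨b', hb', hy⟩ := hex.choose_spec
  obtain ⟨e₁, e₂⟩ := key w _ b b' i hb'.symm hy.symm
  rw [hdec, e₁, e₂]

theorem prob_eq_zero {κ : StateModel} {E : Messages N r → States → Prop}
    (hE : ∀ w b, ¬ E w b) : prob p κ N r E = 0 := by
  simp [prob, hE]

theorem achievable_of_hasZeroErrorCode (κ : StateModel) (p : ℝ) (h₁ : ∀ i, 0 ≤ r.1 i)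
    (h₂ : ∀ i v, 0 ≤ r.2 i v) (h₃ : ∀ i, r.2 i true = 0)
    (h : ∀ᶠ N : ℕ in atTop, HasZeroErrorCode nd nc N (fun i => ⌈(N : ℝ) * r.1 i⌉₊)
      (fun i => ⌈(N : ℝ) * r.1 i⌉₊ + ⌈(N : ℝ) * r.2 i false⌉₊)) :
    Achievable nd nc c κ p r := by
  have hex : ∀ N : ℕ, ∃ C : OppCode nd nc c N r,
      HasZeroErrorCode nd nc N (fun i => ⌈(N : ℝ) * r.1 i⌉₊)
        (fun i => ⌈(N : ℝ) * r.1 i⌉₊ + ⌈(N : ℝ) * r.2 i false⌉₊) →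
      ∀ w b i, C.decoded w b i = ((w i).1, (w i).2 (b i)) := by
    intro N
    by_cases hN : HasZeroErrorCode nd nc N (fun i => ⌈(N : ℝ) * r.1 i⌉₊)
        (fun i => ⌈(N : ℝ) * r.1 i⌉₊ + ⌈(N : ℝ) * r.2 i false⌉₊)
    · obtain ⟨C, hC⟩ := exists_code_decoded_eq (c := c) h₁ h₂ h₃ hN
      exact ⟨C, fun _ => hC⟩
    · have := fun i => nonempty_msg N (h₁ i)
      have := fun i v => nonempty_msg N (h₂ i v)
      exact ⟨⟨fun _ _ _ => 0, fun _ _ _ => Classical.arbitrary _⟩, fun h => absurd h hN⟩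
  choose C hC using hex
  refine ⟨h₁, h₂, h₃, C, ?_, fun i v => ?_⟩
  · refine tendsto_const_nhds.congr' ?_
    filter_upwards [h] with N hN
    refine (prob_eq_zero fun w b => ?_).symm
    rintro ⟨i, hi⟩
    exact hi (by rw [hC N hN])
  · refine tendsto_const_nhds.congr' ?_
    filter_upwards [h] with N hN
    rw [OppCode.oppErr, prob_eq_zero, zero_div]
    rintro w b ⟨-, hb⟩
    exact hb (hC N hN w b i)

theorem eventually_mul_add_le {x s : ℝ} (hx : 0 < x) (hs : s < 1) (K : ℝ) :
    ∀ᶠ N : ℕ in atTop, (N : ℝ) * (s * x) + K ≤ N * x := by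
  have hpos : 0 < (1 - s) * x := mul_pos (sub_pos.2 hs) hx
  filter_upwards [tendsto_natCast_atTop_atTop.eventually_ge_atTop (K / ((1 - s) * x))] with N hN
  rw [div_le_iff₀ hpos] at hN
  linarith

/-- Zero-error codes whose numbers of bits fall short of the rates by a bounded amount place the
rate tuple in the capacity region: a fraction `s < 1` of the rates absorbs this amount. -/
theorem mem_capacityRegion (κ : StateModel) (p : ℝ) (h₁ : ∀ i, 0 ≤ r.1 i)
    (h₂ : ∀ i v, 0 ≤ r.2 i v) (h₃ : ∀ i, r.2 i true = 0) (K : ℝ)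
    (h : ∀ N : ℕ, ∃ a k, HasZeroErrorCode nd nc N a k ∧ ∀ i,
      (N : ℝ) * r.1 i - K ≤ a i ∧ (N : ℝ) * (r.1 i + r.2 i false) - K ≤ k i) :
    r ∈ capacityRegion nd nc c κ p := by
  have hs : ∀ s : ℝ, 0 ≤ s → s < 1 → Achievable nd nc c κ p (s • r) := by
    intro s hs0 hs1
    refine achievable_of_hasZeroErrorCode κ p (fun i => mul_nonneg hs0 (h₁ i))
      (fun i v => mul_nonneg hs0 (h₂ i v)) (fun i => by simp [h₃]) ?_
    have ev : ∀ x : ℝ, 0 ≤ x → ∀ᶠ N : ℕ in atTop, x = 0 ∨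
        (N : ℝ) * (s * x) + (K + 2) ≤ N * x := by
      intro x hx
      rcases hx.eq_or_lt with rfl | hx
      · exact Eventually.of_forall fun _ => Or.inl rfl
      · exact (eventually_mul_add_le hx hs1 _).mono fun _ h => Or.inr h
    have ev₁ := eventually_all.2 fun i => ev (r.1 i) (h₁ i)
    have ev₂ := eventually_all.2 fun i => ev (r.1 i + r.2 i false) (add_nonneg (h₁ i) (h₂ i _))
    filter_upwards [ev₁, ev₂] with N e₁ e₂
    obtain ⟨a, k, hak, hb⟩ := h N
    refine hak.mono (fun i => ?_) (fun i => ?_) (fun i => Nat.le_add_right _ _)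
    · simp only [Prod.smul_fst, Pi.smul_apply, smul_eq_mul]
      rcases e₁ i with h0 | h0
      · simp [h0]
      · have := Nat.ceil_lt_add_one (mul_nonneg (Nat.cast_nonneg N) (mul_nonneg hs0 (h₁ i)))
        have : ((⌈(N : ℝ) * (s * r.1 i)⌉₊ : ℕ) : ℝ) ≤ a i := by linarith [(hb i).1]
        exact_mod_cast this
    · simp only [Prod.smul_fst, Prod.smul_snd, Pi.smul_apply, smul_eq_mul]
      rcases e₂ i with h0 | h0
      · have z₁ : r.1 i = 0 := by linarith [h₁ i, h₂ i false]
        have z₂ : r.2 i false = 0 := by linarith [h₁ i, h₂ i false]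
        simp [z₁, z₂]
      · have c₁ := Nat.ceil_lt_add_one
          (mul_nonneg (Nat.cast_nonneg N) (mul_nonneg hs0 (h₁ i)))
        have c₂ := Nat.ceil_lt_add_one
          (mul_nonneg (Nat.cast_nonneg N) (mul_nonneg hs0 (h₂ i false)))
        have : ((⌈(N : ℝ) * (s * r.1 i)⌉₊ + ⌈(N : ℝ) * (s * r.2 i false)⌉₊ : ℕ) : ℝ) ≤ k i := by
          push_cast
          linarith [(hb i).2]
        exact_mod_cast this
  have hlim : Tendsto (fun n : ℕ => (1 - 1 / ((n : ℝ) + 1)) • r) atTop (𝓝 r) := by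
    simpa using (tendsto_const_nhds.sub tendsto_one_div_add_atTop_nhds_zero_nat
      (a := (1 : ℝ))).smul (tendsto_const_nhds (x := r))
  refine mem_closure_of_tendsto hlim (Eventually.of_forall fun n => hs _ ?_ ?_)
  · rw [sub_nonneg, div_le_one (by positivity)]
    linarith [Nat.cast_nonneg (α := ℝ) n]
  · linarith [Nat.one_div_pos_of_nat (α := ℝ) (n := n)]

/-- Time sharing between two codes for a single channel use. -/
theorem mem_capacityRegion_of_timeSharing (κ : StateModel) (p : ℝ) (h₁ : ∀ i, 0 ≤ r.1 i)
    (h₂ : ∀ i v, 0 ≤ r.2 i v) (h₃ : ∀ i, r.2 i true = 0) {a k a' k' : Fin 2 → ℕ}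
    (h : HasZeroErrorCode nd nc 1 a k) (h' : HasZeroErrorCode nd nc 1 a' k') {μ : ℝ}
    (hμ0 : 0 ≤ μ) (hμ1 : μ ≤ 1) (ha : ∀ i, r.1 i ≤ μ * a i + (1 - μ) * a' i)
    (hk : ∀ i, r.1 i + r.2 i false ≤ μ * k i + (1 - μ) * k' i) :
    r ∈ capacityRegion nd nc c κ p := by
  refine mem_capacityRegion κ p h₁ h₂ h₃ (∑ i, (k i : ℝ)) fun N => ?_
  have hN : (0 : ℝ) ≤ N := Nat.cast_nonneg N
  have m₁ := Nat.floor_le (mul_nonneg hN hμ0)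
  have m₂ := Nat.lt_floor_add_one ((N : ℝ) * μ)
  have hmN : ⌊(N : ℝ) * μ⌋₊ ≤ N := by
    have : (⌊(N : ℝ) * μ⌋₊ : ℝ) ≤ N := by nlinarith
    exact_mod_cast this
  set m := ⌊(N : ℝ) * μ⌋₊
  refine ⟨m • a + (N - m) • a', m • k + (N - m) • k', ?_, ?_⟩
  · have := (h.nsmul m).add (h'.nsmul (N - m))
    rwa [Nat.add_sub_cancel' hmN] at this
  · have bound : ∀ (x : ℝ) (u u' : ℕ), x ≤ μ * u + (1 - μ) * u' →
        (N : ℝ) * x - u ≤ ((m * u + (N - m) * u' : ℕ) : ℝ) := by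
      intro x u u' hx
      push_cast [Nat.cast_sub hmN]
      have e₁ := mul_le_mul_of_nonneg_left hx hN
      have hu : (0 : ℝ) ≤ u := Nat.cast_nonneg u
      have hu' : (0 : ℝ) ≤ u' := Nat.cast_nonneg u'
      nlinarith [mul_nonneg hu (sub_nonneg.2 m₂.le), mul_nonneg hu' (sub_nonneg.2 m₁)]
    intro i
    have hki : (k i : ℝ) ≤ ∑ i, (k i : ℝ) :=
      Finset.single_le_sum (f := fun i => (k i : ℝ)) (fun _ _ => Nat.cast_nonneg _)
        (Finset.mem_univ i)
    have hai : (a i : ℝ) ≤ k i := by exact_mod_cast h.1 i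
    exact ⟨by linarith [bound _ _ _ (ha i), show (((m • a + (N - m) • a') i : ℕ) : ℝ) =
        ((m * a i + (N - m) * a' i : ℕ) : ℝ) from rfl],
      by linarith [bound _ _ _ (hk i), show (((m • k + (N - m) • k') i : ℕ) : ℝ) =
        ((m * k i + (N - m) * k' i : ℕ) : ℝ) from rfl]⟩

end Achievability

/-! ### The opportunistic sum capacity region -/

section Region

variable {nd nc : ℕ} {c : CSI} {p : ℝ}

theorem exists_add_eq_of_le {R u₀ u₁ : ℝ} (hR : 0 ≤ R) (h₀ : 0 ≤ u₀) (h₁ : 0 ≤ u₁)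
    (h : R ≤ u₀ + u₁) : ∃ x y : ℝ, 0 ≤ x ∧ 0 ≤ y ∧ x ≤ u₀ ∧ y ≤ u₁ ∧ x + y = R :=
  ⟨min R u₀, R - min R u₀, le_min hR h₀, sub_nonneg.2 (min_le_left _ _), min_le_right _ _, by
    rcases le_total R u₀ with h' | h'
    · rw [min_eq_left h']
      linarith
    · rw [min_eq_right h']
      linarith, by ring⟩

/-- Rates that a single symmetric code supports, with the worst-case sum rate `R` split between
the users according to their opportunistic rates. -/
theorem exists_split_mem_capacityRegion (κ : StateModel) (p : ℝ) {a k : ℕ}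
    (h : HasZeroErrorCode nd nc 1 ![a, a] ![k, k]) {R : ℝ} {D : Fin 2 → Bool → ℝ} (hR : 0 ≤ R)
    (hD : ∀ i v, 0 ≤ D i v) (hD' : ∀ i, D i true = 0) (hk : ∀ i, D i false ≤ k)
    (hRa : R ≤ 2 * a) (hRk : ∀ i, R + D i false ≤ a + k)
    (hsum : R + D 0 false + D 1 false ≤ 2 * k) :
    ∃ R' : Fin 2 → ℝ, R' 0 + R' 1 = R ∧ (R', D) ∈ capacityRegion nd nc c κ p := by
  have ha : (0 : ℝ) ≤ a := Nat.cast_nonneg a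
  obtain ⟨x, y, hx, hy, hxu, hyu, hxy⟩ := exists_add_eq_of_le hR
    (u₀ := min (a : ℝ) (k - D 0 false)) (u₁ := min (a : ℝ) (k - D 1 false))
    (le_min ha (sub_nonneg.2 (hk 0))) (le_min ha (sub_nonneg.2 (hk 1))) (by
      rcases min_cases (a : ℝ) (k - D 0 false) with ⟨h0, -⟩ | ⟨h0, -⟩ <;>
      rcases min_cases (a : ℝ) (k - D 1 false) with ⟨h1, -⟩ | ⟨h1, -⟩ <;>
      rw [h0, h1] <;> linarith [hRk 0, hRk 1])
  rw [le_min_iff] at hxu hyu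
  refine ⟨![x, y], hxy, mem_capacityRegion_of_timeSharing κ p
    (by simp [Fin.forall_fin_two, hx, hy]) hD hD' h h zero_le_one le_rfl ?_ ?_⟩
  · simp only [Fin.forall_fin_two, Matrix.cons_val_zero, Matrix.cons_val_one,
      Matrix.cons_val_fin_one]
    constructor <;> linarith
  · simp only [Fin.forall_fin_two, Matrix.cons_val_zero, Matrix.cons_val_one,
      Matrix.cons_val_fin_one]
    constructor <;> linarith

/-- Rates obtained by time sharing between a symmetric code with `k - a` opportunistic bits per user and a code that
has a larger worst-case sum rate. -/
theorem exists_shared_mem_capacityRegion (κ : StateModel) (p : ℝ) {a k a₀ a₁ k₀ k₁ : ℕ}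
    (h : HasZeroErrorCode nd nc 1 ![a, a] ![k, k])
    (h' : HasZeroErrorCode nd nc 1 ![a₀, a₁] ![k₀, k₁]) {R : ℝ} {D : Fin 2 → Bool → ℝ}
    (hD : ∀ i v, 0 ≤ D i v) (hD' : ∀ i, D i true = 0) (hRa : 2 * a < R) (hRa' : R ≤ a₀ + a₁)
    (hsum₀ : (a : ℝ) + k = k₀ + a₁) (hsum₁ : (a : ℝ) + k = a₀ + k₁)
    (hRD : ∀ i, R + D i false ≤ a + k) :
    ∃ R' : Fin 2 → ℝ, R' 0 + R' 1 = R ∧ (R', D) ∈ capacityRegion nd nc c κ p := by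
  have hpos : (0 : ℝ) < a₀ + a₁ - 2 * a := by linarith
  -- the fraction of time for which the shared worst-case sum rate is exactly `R`
  obtain ⟨μ, hμ⟩ : ∃ μ : ℝ, μ = (a₀ + a₁ - R) / (a₀ + a₁ - 2 * a) := ⟨_, rfl⟩
  have hμ0 : 0 ≤ μ := hμ ▸ div_nonneg (by linarith) hpos.le
  have hμ1 : μ ≤ 1 := hμ ▸ (div_le_one hpos).2 (by linarith)
  have hR : R = μ * (2 * a) + (1 - μ) * (a₀ + a₁) := by
    have : μ * (a₀ + a₁ - 2 * a) = a₀ + a₁ - R := by rw [hμ, div_mul_cancel₀ _ hpos.ne']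
    linarith
  have n : ∀ u : ℕ, 0 ≤ μ * a + (1 - μ) * u := fun u =>
    add_nonneg (mul_nonneg hμ0 (Nat.cast_nonneg _))
      (mul_nonneg (sub_nonneg.2 hμ1) (Nat.cast_nonneg _))
  refine ⟨![μ * a + (1 - μ) * a₀, μ * a + (1 - μ) * a₁], ?_,
    mem_capacityRegion_of_timeSharing κ p (by simp [Fin.forall_fin_two, n]) hD hD' h h' hμ0 hμ1
      ?_ ?_⟩
  · simp only [Matrix.cons_val_zero, Matrix.cons_val_one, Matrix.cons_val_fin_one]
    rw [hR]
    ring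
  · simp [Fin.forall_fin_two]
  · simp only [Fin.forall_fin_two, Matrix.cons_val_zero, Matrix.cons_val_one,
      Matrix.cons_val_fin_one]
    have d₀ := hRD 0
    have d₁ := hRD 1
    constructor
    · have e : (k₀ : ℝ) = k + a - a₁ := by linarith
      rw [e]
      linarith
    · have e : (k₁ : ℝ) = k + a - a₀ := by linarith
      rw [e]
      linarith

theorem boundRegion_subset (κ : StateModel) (p : ℝ) :
    boundRegion nd nc ⊆ oppSumCapacityRegion nd nc c κ p := by
  rintro _ ⟨R, D, rfl, hR, hD, hD', h2n, hz, ht, hs, hzD, hDn⟩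
  have hDv : ∀ i v, 0 ≤ D i v := fun i v => by
    cases v
    · exact hD i
    · exact (hD' i).ge
  suffices ∃ R' : Fin 2 → ℝ, R' 0 + R' 1 = R ∧ (R', D) ∈ capacityRegion nd nc c κ p by
    obtain ⟨R', hR', hmem⟩ := this
    exact ⟨(R', D), hmem, Prod.ext hR' rfl⟩
  have D0 := hD 0
  rcases le_total nc nd with hle | hle
  · obtain ⟨s, rfl⟩ := Nat.exists_eq_add_of_le hle
    have hs0 : (0 : ℝ) ≤ s := Nat.cast_nonneg s
    have hc0 : (0 : ℝ) ≤ nc := Nat.cast_nonneg nc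
    push_cast at *
    rw [add_sub_cancel_left, max_eq_left hs0, max_eq_left (by linarith)] at hz
    simp only [add_sub_cancel_left, max_eq_left hs0,
      max_eq_left (show (nc : ℝ) ≤ nc + s by linarith)] at hzD ht
    rcases le_or_gt R (2 * s) with hRs | hRs
    · exact exists_split_mem_capacityRegion κ p (hasZeroErrorCode_weak nc s) hR hDv hD'
        (by push_cast; exact hDn) hRs (by push_cast; exact hzD) (by push_cast; exact hs)
    · have hsc : s < nc := by
        by_contra hcs
        have : (nc : ℝ) ≤ s := by exact_mod_cast not_lt.1 hcs
        rw [max_eq_left this] at ht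
        linarith
      have hsc' : (s : ℝ) ≤ nc := by exact_mod_cast hsc.le
      rw [max_eq_right hsc'] at ht
      rcases le_total nc (2 * s) with h | h
      · exact exists_shared_mem_capacityRegion κ p (hasZeroErrorCode_weak nc s)
          (hasZeroErrorCode_moderate hsc.le h) hDv hD' hRs (by linarith) (by push_cast; ring)
          (by push_cast; ring) (by push_cast; exact hzD)
      · exact exists_shared_mem_capacityRegion κ p (hasZeroErrorCode_weak nc s)
          (hasZeroErrorCode_high h) hDv hD' hRs (by push_cast; linarith) (by push_cast; ring)
          (by push_cast; ring) (by push_cast; exact hzD)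
  · obtain ⟨s, rfl⟩ := Nat.exists_eq_add_of_le hle
    have hs0 : (0 : ℝ) ≤ s := Nat.cast_nonneg s
    have hn0 : (0 : ℝ) ≤ nd := Nat.cast_nonneg nd
    push_cast at *
    have e₁ : max ((nd : ℝ) - (nd + s)) 0 = 0 := max_eq_right (by linarith)
    have e₂ : max (nd : ℝ) (nd + s) = nd + s := max_eq_right (by linarith)
    rw [e₁, e₂, zero_add] at hz
    simp only [e₁, e₂, zero_add] at hzD
    rcases le_total nd s with h | h
    · have h' : (nd : ℝ) ≤ s := by exact_mod_cast h
      have hcode := hasZeroErrorCode_strong nd s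
      rw [min_eq_left h] at hcode
      exact exists_split_mem_capacityRegion κ p hcode hR hDv hD' hDn h2n
        (fun i => by fin_cases i <;> simp <;> linarith [hD 0, hD 1]) hs
    · have h' : (s : ℝ) ≤ nd := by exact_mod_cast h
      have hcode := hasZeroErrorCode_strong nd s
      rw [min_eq_right h] at hcode
      rcases le_or_gt R (2 * s) with hRs | hRs
      · exact exists_split_mem_capacityRegion κ p hcode hR hDv hD' hDn hRs
          (fun i => by linarith [hzD i]) hs
      · exact exists_shared_mem_capacityRegion κ p hcode (hasZeroErrorCode_strong_corner h)
          hDv hD' hRs hz (by ring) (by ring) (fun i => by linarith [hzD i])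

theorem oppSumCapacityRegion_eq (hp0 : 0 < p) (hp1 : p < 1) {κ : StateModel}
    (hκ : κ = .independent ∨ c = .localCSIR) :
    oppSumCapacityRegion nd nc c κ p = boundRegion nd nc :=
  (oppSumCapacityRegion_subset hp0 hp1 hκ).antisymm (boundRegion_subset κ p)

end Region

end BurstyIC

theorem theorem3 (nd nc : ℕ) (p : ℝ) (hp0 : 0 < p) (hp1 : p < 1) :
    BurstyIC.oppSumCapacityRegion nd nc .localCSIR .independent p = BurstyIC.boundRegion nd nc ∧
    BurstyIC.oppSumCapacityRegion nd nc .localCSIRT .independent p = BurstyIC.boundRegion nd nc ∧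
    BurstyIC.oppSumCapacityRegion nd nc .localCSIR .fullyCorrelated p =
      BurstyIC.boundRegion nd nc := by
  exact ⟨BurstyIC.oppSumCapacityRegion_eq hp0 hp1 (.inl rfl),
    BurstyIC.oppSumCapacityRegion_eq hp0 hp1 (.inl rfl),
    BurstyIC.oppSumCapacityRegion_eq hp0 hp1 (.inr rfl)⟩
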